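/- Let $b\ge 1$ be an integer and let $\mathcal V=(V_1,\dots,V_b)$ be a random vector with $V_i\ge 0$ and $\sum_{i=1}^b V_i=1$ almost surely, whose components are identically distributed; let $V$ be a random variable with their common distribution. Assume that $\mathbf P(V=1)=0$, $\mathbf P(V=0)=0$, and that $-\ln V$ is non-lattice, i.e. there is no $d>0$ such that $-\ln V\in d\mathbb Z$ almost surely. Let $\Delta=V_S$ be the size-biased variable: given $(V_1,\dots,V_b)$, the index $S$ equals $j$ with probability $V_j$. Put $$\mu=\mathbf E(-\ln\Delta),\qquad \sigma^2=\mathbf{Var}(\ln\Delta).$$ Let $W_1,W_2,\dots$ be independent random variables distributed as $V$, let $Y_k=-\sum_{j=1}^k\ln W_j$, and define the renewal function $$U(t)=\sum_{k=1}^\infty b^k\,\mathbf P(Y_k\le t),\qquad t\in\mathbb R.$$ Then $\ln\Delta$ has a finite second moment, $\mu>0$, the series $U(t)$ converges for every real $t$, the function $t\mapsto e^{-t}\bigl(U(t)-\mu^{-1}e^{t}\bigr)$ is integrable on $[0,x]$ for every $x\ge 0$, and the function $$W(x)=\int_0^x e^{-t}\bigl(U(t)-\mu^{-1}e^{t}\bigr)\,dt$$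 satisfies $$W(x)=\frac{\sigma^2-\mu^2}{2\mu^2}-\mu^{-1}+o(1)\qquad\text{as }x\to\infty.$$ -/

import Mathlib

open MeasureTheory ProbabilityTheory Filter
open scoped Topology

noncomputable section

namespace SplitTree

/-- `𝒱 = (V_1, …, V_b)` is a random split vector: a random vector of probabilities,
with nonnegative components that sum to one. -/
structure IsSplitVector {Ω : Type*} [MeasurableSpace Ω] (P : Measure Ω) {b : ℕ}
    (𝒱 : Ω → Fin b → ℝ) : Prop where
  measurable : Measurable 𝒱
  nonneg : ∀ᵐ ω ∂P, ∀ i, 0 ≤ 𝒱 ω i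
  sum_eq_one : ∀ᵐ ω ∂P, ∑ i, 𝒱 ω i = 1

/-- A real random variable is lattice if it is almost surely in `d ℤ` for some `d > 0`,
and non-lattice otherwise. -/
def NonLattice {Ω : Type*} [MeasurableSpace Ω] (P : Measure Ω) (X : Ω → ℝ) : Prop :=
  ¬ ∃ d : ℝ, 0 < d ∧ ∀ᵐ ω ∂P, ∃ n : ℤ, X ω = n * d

/-- The law of the size-biased variable `Δ = V_S`, where, given `(V_1, …, V_b)`, the index `S`
equals `j` with probability `V_j`; that is, `P(Δ ∈ A) = ∑_j E(V_j ; V_j ∈ A)`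
(see `sizeBiasedLaw_apply`). -/
def sizeBiasedLaw {Ω : Type*} [MeasurableSpace Ω] (P : Measure Ω) {b : ℕ}
    (𝒱 : Ω → Fin b → ℝ) : Measure ℝ :=
  ∑ j, (P.withDensity fun ω => ENNReal.ofReal (𝒱 ω j)).map fun ω => 𝒱 ω j

theorem sizeBiasedLaw_apply {Ω : Type*} [MeasurableSpace Ω] (P : Measure Ω) {b : ℕ}
    (𝒱 : Ω → Fin b → ℝ) (h𝒱 : Measurable 𝒱) {A : Set ℝ} (hA : MeasurableSet A) :
    sizeBiasedLaw P 𝒱 A =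
      ∑ j, ∫⁻ ω in {ω | 𝒱 ω j ∈ A}, ENNReal.ofReal (𝒱 ω j) ∂P := by
  have hj : ∀ j, Measurable fun ω => 𝒱 ω j := fun j => (measurable_pi_apply j).comp h𝒱
  simp only [sizeBiasedLaw, Measure.finsetSum_apply]
  refine Finset.sum_congr rfl fun j _ => ?_
  rw [Measure.map_apply (hj j) hA, withDensity_apply _ (hj j hA)]
  rfl

/-- `μ = E(-ln Δ)`. -/
def mu {Ω : Type*} [MeasurableSpace Ω] (P : Measure Ω) {b : ℕ} (𝒱 : Ω → Fin b → ℝ) : ℝ :=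
  ∫ x, -Real.log x ∂(sizeBiasedLaw P 𝒱)

/-- `σ² = Var(ln Δ)`. -/
def sigmaSq {Ω : Type*} [MeasurableSpace Ω] (P : Measure Ω) {b : ℕ}
    (𝒱 : Ω → Fin b → ℝ) : ℝ :=
  variance Real.log (sizeBiasedLaw P 𝒱)

/-- `Y_k = -∑_{j=1}^k ln W_j`; the sequence `W_1, W_2, …` is indexed from `0` here. -/
def Y {Ω : Type*} (W : ℕ → Ω → ℝ) (k : ℕ) (ω : Ω) : ℝ :=
  -∑ j ∈ Finset.range k, Real.log (W j ω)

/-- `ν_k(t) = b^k P(Y_k ≤ t)`. -/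
def nu {Ω : Type*} [MeasurableSpace Ω] (Q : Measure Ω) (b : ℕ) (W : ℕ → Ω → ℝ)
    (k : ℕ) (t : ℝ) : ℝ :=
  (b : ℝ) ^ k * Q.real {ω | Y W k ω ≤ t}

/-- The renewal function `U(t) = ∑_{k ≥ 1} ν_k(t)`. -/
def U {Ω : Type*} [MeasurableSpace Ω] (Q : Measure Ω) (b : ℕ) (W : ℕ → Ω → ℝ) (t : ℝ) : ℝ :=
  ∑' k : ℕ, nu Q b W (k + 1) t

end SplitTree

end

/-! Exponential tilting turns the problem into a renewal theorem. Let `F` be the law of `-ln Δ`.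
Since the components share one law, `F(dy) = b e^{-y} P(-ln V ∈ dy)`, so the functions `n_k(t) =
e^{-t} ν_k(t)` satisfy `n_{k+1} = F * n_k`, with `n_0` the standard exponential density. Hence `u(t)
= e^{-t} U(t) = ∑_{k ≥ 1} n_k(t)` solves `u = n_1 + F * u`, and the claim concerns `W(x) = ∫_0^x u -
x/μ`.

Everything rests on one identity (`IsCausal.integral_window`): the `F`-average over `y` of
`∫_{x-y}^x f` equals `∫_0^x (f - F * f)`. For partial sums of `u` the right side is at most 1; as
`e^t u(t)` is increasing, this gives a uniform bound, hence convergence and a Lipschitz `W`. For `W`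
itself the defect `W - F * W` is explicit, tends to 0, and has total integral `c = E Y²/(2μ) - (1 +
μ)`, where `Y` has law `F`. So the window averages of `W` tend to `c`.

It remains to see that `W` converges (`tendsto_of_renewal`). Along a sequence on which `W` attains
its upper limit `l`, the vanishing defect forces `W` to be near `l` also at translates by points of
the support of `F`, hence by the semigroup they generate. By non-latticeness that semigroup becomes
arbitrarily fine far out, so `W` is near or above `l` on whole windows and `l μ ≤ c`. The same for
`-W` bounds the lower limit, so `W → c/μ`; with `E Y² = σ² + μ²` this is the stated constant. -/

/-! ### Convergence of approximate solutions of the renewal equation -/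

/-- A submonoid of `[0, ∞)` that generates a dense subgroup of `ℝ` is asymptotically dense. -/
theorem AddSubmonoid.exists_forall_ge_exists_abs_sub_lt {S : AddSubmonoid ℝ}
    (hnn : ∀ s ∈ S, 0 ≤ s) (hd : Dense (AddSubgroup.closure (S : Set ℝ) : Set ℝ))
    {ε : ℝ} (hε : 0 < ε) : ∃ L : ℝ, ∀ y ≥ L, ∃ s ∈ S, |y - s| < ε := by
  obtain ⟨g, hg, hgpos, hgε⟩ := hd.exists_between hε
  have hdiff : ∀ x ∈ AddSubgroup.closure (S : Set ℝ), ∃ a ∈ S, ∃ b ∈ S, x = b - a := by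
    intro x hx
    induction hx using AddSubgroup.closure_induction with
    | mem x hx => exact ⟨0, S.zero_mem, x, hx, by simp⟩
    | zero => exact ⟨0, S.zero_mem, 0, S.zero_mem, by simp⟩
    | add x y _ _ hx hy =>
      obtain ⟨a, ha, b, hb, rfl⟩ := hx
      obtain ⟨a', ha', b', hb', rfl⟩ := hy
      exact ⟨a + a', S.add_mem ha ha', b + b', S.add_mem hb hb', by ring⟩
    | neg x _ hx =>
      obtain ⟨a, ha, b, hb, rfl⟩ := hx
      exact ⟨b, hb, a, ha, by ring⟩
  obtain ⟨a, ha, b, hb, rfl⟩ := hdiff g hg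
  have ha0 := hnn a ha
  have hbpos : 0 < b := by linarith
  -- Beyond this threshold `n = ⌈y / b⌉` satisfies `n a ≤ y ≤ n b`. The elements `(n - k) a + k b`,
  -- `0 ≤ k ≤ n`, climb from `n a` to `n b` in steps `b - a < ε`.
  refine ⟨a * b / (b - a), fun y hy => ?_⟩
  have hy' : a * b ≤ y * (b - a) := (div_le_iff₀ hgpos).1 hy
  have hy0 : 0 ≤ y := le_trans (by positivity) hy
  set n := ⌈y / b⌉₊ with hn
  have hn1 : y ≤ n * b := (div_le_iff₀ hbpos).1 (Nat.le_ceil _)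
  have hn2 : n * a ≤ y := by
    have h1 : (n : ℝ) < y / b + 1 := Nat.ceil_lt_add_one (by positivity)
    have h2 : (y / b + 1) * a ≤ y := by
      rw [div_add_one hbpos.ne', div_mul_eq_mul_div, div_le_iff₀ hbpos]
      nlinarith
    nlinarith
  set k := ⌊(y - n * a) / (b - a)⌋₊ with hk
  have hk0 : 0 ≤ (y - n * a) / (b - a) := div_nonneg (by linarith) hgpos.le
  have hk1 : k * (b - a) ≤ y - n * a := (le_div_iff₀ hgpos).1 (Nat.floor_le hk0)
  have hk2 : y - n * a < (k + 1) * (b - a) := (div_lt_iff₀ hgpos).1 (Nat.lt_floor_add_one _)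
  have hkn : k ≤ n := by
    have h1 : (k : ℝ) * (b - a) ≤ n * (b - a) := by linarith
    exact_mod_cast le_of_mul_le_mul_right h1 hgpos
  refine ⟨(n - k) • a + k • b, S.add_mem (S.nsmul_mem ha _) (S.nsmul_mem hb _), ?_⟩
  rw [nsmul_eq_mul, nsmul_eq_mul, Nat.cast_sub hkn, abs_lt]
  constructor <;> nlinarith

/-- If `W` almost solves the renewal equation, then values of `W` that are close to its upper
limit propagate to translates by points of the support. -/
theorem tendsto_sub_of_mem_support {F : Measure ℝ} [IsProbabilityMeasure F] {W : ℝ → ℝ}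
    {K : NNReal} (hW : LipschitzWith K W) {B : ℝ} (hB : ∀ x, |W x| ≤ B)
    (hw : Tendsto (fun x => W x - ∫ y, W (x - y) ∂F) atTop (𝓝 0)) {l : ℝ}
    (hl : ∀ a, l < a → ∀ᶠ x in atTop, W x < a)
    {t : ℕ → ℝ} (ht : Tendsto t atTop atTop) (htl : Tendsto (fun n => W (t n)) atTop (𝓝 l))
    {y : ℝ} (hy : y ∈ F.support) : Tendsto (fun n => W (t n - y)) atTop (𝓝 l) := by
  have hshift : ∀ z, Tendsto (fun n => t n - z) atTop atTop := fun z =>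
    tendsto_atTop_add_const_right _ (-z) ht
  have hWc := hW.continuous
  -- Values above `l` are asymptotically negligible, so truncating below at `l` leaves the constant
  -- `l`. Any loss in the average can then come only from values of `W` below `l`.
  have hmax : Tendsto (fun n => ∫ z, max (W (t n - z)) l ∂F) atTop (𝓝 (∫ _, l ∂F)) := by
    refine tendsto_integral_of_dominated_convergence (fun _ => max B |l|) (fun n => ?_)
      (integrable_const _) (fun n => ?_) ?_
    · exact (by fun_prop : Continuous fun z => max (W (t n - z)) l).aestronglyMeasurable
    · refine Eventually.of_forall fun z => ?_
      rw [Real.norm_eq_abs]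
      exact abs_max_le_max_abs_abs.trans (max_le_max (hB _) le_rfl)
    · refine Eventually.of_forall fun z => ?_
      refine tendsto_order.2 ⟨fun a ha => Eventually.of_forall fun n => lt_max_of_lt_right ha,
        fun a ha => ?_⟩
      filter_upwards [(hshift z).eventually (hl a ha)] with n hn
      exact max_lt hn ha
  refine tendsto_order.2 ⟨fun a ha => ?_, fun a ha => (hshift y).eventually (hl a ha)⟩
  by_contra hcon
  set d := l - a with hd
  have hdpos : 0 < d := by linarith
  -- A value at most `l - d` at `t n - y` keeps `W` below `l - d/2` for all shifts in this ball.
  -- That costs the average at least `d/2 * p`, against a defect tending to 0. The `+ 1` covers `K =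
  -- 0`.
  set r := d / (2 * (K + 1)) with hr
  have hrpos : 0 < r := by positivity
  have hKr : K * r ≤ d / 2 := by
    have : (K + 1) * r = d / 2 := by rw [hr]; field_simp
    nlinarith
  set p := F.real (Metric.ball y r) with hp
  have hppos : 0 < p := by
    refine ENNReal.toReal_pos ?_ (measure_ne_top _ _)
    exact ((Measure.mem_support_iff_forall y).1 hy _ (Metric.ball_mem_nhds y hrpos)).ne'
  have hlim : Tendsto (fun n => W (t n) - (W (t n) - ∫ z, W (t n - z) ∂F)
      - ∫ z, max (W (t n - z)) l ∂F) atTop (𝓝 (l - 0 - ∫ _, l ∂F)) :=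
    (htl.sub (hw.comp ht)).sub hmax
  have hlim0 : l - 0 - ∫ _, l ∂F = 0 := by simp
  rw [hlim0] at hlim
  have hev := hlim.eventually (lt_mem_nhds (show -(d / 2 * p) < 0 by
    have := mul_pos (half_pos hdpos) hppos
    linarith))
  refine hcon ?_
  filter_upwards [hev] with n hn
  by_contra hna
  push Not at hna
  refine absurd hn (not_lt.2 ?_)
  have hint1 : Integrable (fun z => W (t n - z)) F := by
    refine Integrable.of_bound (by fun_prop : Continuous _).aestronglyMeasurable B ?_
    exact Eventually.of_forall fun z => hB _
  have hint2 : Integrable (fun z => max (W (t n - z)) l) F := by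
    refine Integrable.of_bound (by fun_prop : Continuous _).aestronglyMeasurable (max B |l|) ?_
    exact Eventually.of_forall fun z =>
      abs_max_le_max_abs_abs.trans (max_le_max (hB _) le_rfl)
  have hsub : W (t n) - (W (t n) - ∫ z, W (t n - z) ∂F) - ∫ z, max (W (t n - z)) l ∂F
      = ∫ z, (W (t n - z) - max (W (t n - z)) l) ∂F := by
    rw [integral_sub hint1 hint2]; ring
  rw [hsub]
  have hind : ∫ z, (Metric.ball y r).indicator (fun _ => -(d / 2)) z ∂F = -(d / 2 * p) := by
    rw [integral_indicator Metric.isOpen_ball.measurableSet]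
    simp [hp]; ring
  rw [← hind]
  refine integral_mono (hint1.sub hint2)
    ((integrable_const _).indicator Metric.isOpen_ball.measurableSet) fun z => ?_
  by_cases hz : z ∈ Metric.ball y r
  · rw [Set.indicator_of_mem hz]
    have h1 : |W (t n - z) - W (t n - y)| ≤ K * r := by
      have h2 := hW.dist_le_mul (t n - z) (t n - y)
      rw [Real.dist_eq, dist_sub_left] at h2
      exact h2.trans (mul_le_mul_of_nonneg_left (Metric.mem_ball.1 hz).le K.2)
    have h3 := (abs_le.1 h1).2
    have h4 := le_max_right (W (t n - z)) l
    show _ - _ ≤ _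
    linarith
  · rw [Set.indicator_of_notMem hz]
    have h4 := le_max_left (W (t n - z)) l
    show _ - _ ≤ _
    linarith

/-- The upper half of `tendsto_of_renewal`. -/
theorem eventually_lt_of_renewal {F : Measure ℝ} [IsProbabilityMeasure F]
    (hF0 : ∀ᵐ y ∂F, 0 ≤ y) (hFi : Integrable (fun y => y) F) (hμ : 0 < ∫ y, y ∂F)
    (hdense : Dense (AddSubgroup.closure F.support : Set ℝ)) {W : ℝ → ℝ}
    {K : NNReal} (hW : LipschitzWith K W) {B : ℝ} (hB : ∀ x, |W x| ≤ B)
    (hw : Tendsto (fun x => W x - ∫ y, W (x - y) ∂F) atTop (𝓝 0)) {c : ℝ}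
    (hJ : Tendsto (fun x => ∫ y, (∫ s in (0 : ℝ)..y, W (x - s)) ∂F) atTop (𝓝 c))
    {a : ℝ} (ha : c / (∫ y, y ∂F) < a) : ∀ᶠ x in atTop, W x < a := by
  have hWc := hW.continuous
  have hbdd : IsBoundedUnder (· ≤ ·) atTop W :=
    isBoundedUnder_of ⟨B, fun x => (abs_le.1 (hB x)).2⟩
  have hbdd' : IsBoundedUnder (· ≥ ·) atTop W :=
    isBoundedUnder_of ⟨-B, fun x => (abs_le.1 (hB x)).1⟩
  set l := limsup W atTop with hl_def
  have hl : ∀ a, l < a → ∀ᶠ x in atTop, W x < a := fun a h => eventually_lt_of_limsup_lt h hbdd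
  refine hl a (lt_of_le_of_lt ?_ ha)
  obtain ⟨t, htl, ht⟩ := exists_seq_tendsto_limsup (f := (atTop : Filter ℝ)) (u := W)
    hbdd'.isCoboundedUnder_le hbdd
  have htl : Tendsto (fun n => W (t n)) atTop (𝓝 l) := htl
  -- Each translated sequence again realises the upper limit, so the propagation step can be
  -- iterated.
  have hsemi : ∀ y ∈ AddSubmonoid.closure F.support,
      Tendsto (fun n => W (t n - y)) atTop (𝓝 l) := by
    intro y hy
    induction hy using AddSubmonoid.closure_induction_right with
    | zero => simpa using htl
    | add_right x _ y hy hx =>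
      have := tendsto_sub_of_mem_support hW hB hw hl
        (tendsto_atTop_add_const_right _ (-x) ht) hx hy
      refine this.congr fun n => ?_
      congr 1; ring
  have hsupp : F.support ⊆ Set.Ici 0 := Measure.support_subset_of_isClosed isClosed_Ici hF0
  have hnn : ∀ s ∈ AddSubmonoid.closure F.support, (0 : ℝ) ≤ s := by
    intro s hs
    induction hs using AddSubmonoid.closure_induction with
    | mem x hx => exact hsupp hx
    | zero => exact le_rfl
    | add x y _ _ hx hy => exact add_nonneg hx hy
  have hdense' : Dense (AddSubgroup.closure
      ((AddSubmonoid.closure F.support : AddSubmonoid ℝ) : Set ℝ) : Set ℝ) :=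
    hdense.mono (AddSubgroup.closure_mono AddSubmonoid.subset_closure)
  have key : ∀ ε > 0, (l - ε) * ∫ y, y ∂F ≤ c := by
    intro ε hε
    obtain ⟨L, hL⟩ := AddSubmonoid.exists_forall_ge_exists_abs_sub_lt hnn hdense'
      (show 0 < ε / (2 * (K + 1)) by positivity)
    have hnear : ∀ y ≥ L, ∀ᶠ n in atTop, l - ε ≤ W (t n - y) := by
      intro y hy
      obtain ⟨s, hs, hys⟩ := hL y hy
      filter_upwards [(hsemi s hs).eventually (lt_mem_nhds (show l - ε / 2 < l by linarith))]
        with n hn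
      have h1 : |W (t n - y) - W (t n - s)| ≤ ε / 2 := by
        have h2 := hW.dist_le_mul (t n - y) (t n - s)
        rw [Real.dist_eq, dist_sub_left, Real.dist_eq] at h2
        refine h2.trans ?_
        have h3 : (K + 1) * (ε / (2 * (K + 1))) = ε / 2 := by field_simp
        have := abs_nonneg (y - s)
        have := K.2
        nlinarith [show (0:ℝ) ≤ K from K.2]
      have := (abs_le.1 h1).1
      linarith
    have hshift : Tendsto (fun n => t n - L) atTop atTop :=
      tendsto_atTop_add_const_right _ (-L) ht
    set B' := max B |l - ε| with hB'
    have hB'0 : 0 ≤ B' := le_max_of_le_right (abs_nonneg _)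
    have hbd : ∀ x, ‖min (W x) (l - ε)‖ ≤ B' := fun x =>
      abs_min_le_max_abs_abs.trans (max_le_max (hB _) le_rfl)
    -- The windows end at `t n - L`, so all their points lie at distance at least `L` from `t n`,
    -- where `W` is eventually at least `l - ε`. Truncation from above supplies the bound for
    -- dominated convergence and only lowers the average.
    have hlim : Tendsto (fun n => ∫ y, (∫ s in (0 : ℝ)..y, min (W (t n - L - s)) (l - ε)) ∂F)
        atTop (𝓝 (∫ y, (l - ε) * y ∂F)) := by
      refine tendsto_integral_of_dominated_convergence (fun y => B' * |y|) (fun n => ?_)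
        (hFi.abs.const_mul _) (fun n => ?_) ?_
      · exact (intervalIntegral.continuous_primitive (fun a b =>
          Continuous.intervalIntegrable (by fun_prop) a b) 0).aestronglyMeasurable
      · refine Eventually.of_forall fun y => ?_
        simpa using intervalIntegral.norm_integral_le_of_norm_le_const
          (a := 0) (b := y) (fun s _ => hbd (t n - L - s))
      · filter_upwards [hF0] with y hy
        have h0 : (l - ε) * y = ∫ s in (0 : ℝ)..y, (l - ε) := by
          rw [intervalIntegral.integral_const, smul_eq_mul, sub_zero, mul_comm]
        rw [h0]
        refine intervalIntegral.tendsto_integral_filter_of_dominated_convergence (fun _ => B')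
          (Eventually.of_forall fun n => ?_) (Eventually.of_forall fun n => ?_)
          intervalIntegrable_const ?_
        · exact (by fun_prop : Continuous fun s => min (W (t n - L - s)) (l - ε)).aestronglyMeasurable
        · exact Eventually.of_forall fun s _ => hbd _
        · refine Eventually.of_forall fun s hs => ?_
          rw [Set.uIoc_of_le hy] at hs
          refine tendsto_const_nhds.congr' ?_
          filter_upwards [hnear (L + s) (by linarith [hs.1])] with n hn
          rw [sub_sub, min_eq_right hn]
    have hle : ∫ y, (l - ε) * y ∂F ≤ c := by
      refine le_of_tendsto_of_tendsto' hlim (hJ.comp hshift) fun n => ?_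
      have hprim : ∀ {f : ℝ → ℝ} {M : ℝ}, Continuous f → (∀ s, ‖f s‖ ≤ M) →
          Integrable (fun y => ∫ s in (0 : ℝ)..y, f s) F := by
        intro f M hf hM
        refine Integrable.mono' (hFi.abs.const_mul M)
          (intervalIntegral.continuous_primitive
            (fun a b => hf.intervalIntegrable a b) 0).aestronglyMeasurable ?_
        refine Eventually.of_forall fun y => ?_
        simpa using intervalIntegral.norm_integral_le_of_norm_le_const
          (a := 0) (b := y) (fun s _ => hM s)
      have hc1 : Continuous fun s => min (W (t n - L - s)) (l - ε) := by fun_prop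
      have hc2 : Continuous fun s => W (t n - L - s) := by fun_prop
      refine integral_mono_ae (hprim hc1 fun s => hbd _) (hprim hc2 fun s => hB _) ?_
      filter_upwards [hF0] with y hy
      exact intervalIntegral.integral_mono hy (hc1.intervalIntegrable _ _)
        (hc2.intervalIntegrable _ _) fun s => min_le_left _ _
    rwa [integral_const_mul] at hle
  rw [le_div_iff₀ hμ]
  refine le_of_forall_pos_le_add fun δ hδ => ?_
  have := key (δ / ∫ y, y ∂F) (by positivity)
  rw [sub_mul, div_mul_cancel₀ _ hμ.ne'] at this
  linarith

/-- A bounded Lipschitz function `W` that almost solves the renewal equation `W = F * W`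
converges at infinity; the limit is read off from the limit of the averages
`∫ (∫ s in 0..y, W (x - s)) dF(y)`. -/
theorem tendsto_of_renewal {F : Measure ℝ} [IsProbabilityMeasure F]
    (hF0 : ∀ᵐ y ∂F, 0 ≤ y) (hFi : Integrable (fun y => y) F) (hμ : 0 < ∫ y, y ∂F)
    (hdense : Dense (AddSubgroup.closure F.support : Set ℝ)) {W : ℝ → ℝ}
    {K : NNReal} (hW : LipschitzWith K W) {B : ℝ} (hB : ∀ x, |W x| ≤ B)
    (hw : Tendsto (fun x => W x - ∫ y, W (x - y) ∂F) atTop (𝓝 0)) {c : ℝ}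
    (hJ : Tendsto (fun x => ∫ y, (∫ s in (0 : ℝ)..y, W (x - s)) ∂F) atTop (𝓝 c)) :
    Tendsto W atTop (𝓝 (c / ∫ y, y ∂F)) := by
  refine tendsto_order.2 ⟨fun a ha => ?_, fun a ha =>
    eventually_lt_of_renewal hF0 hFi hμ hdense hW hB hw hJ ha⟩
  have h := eventually_lt_of_renewal (W := fun x => -W x) (c := -c) (B := B) (a := -a)
    hF0 hFi hμ hdense hW.neg (fun x => by simpa using hB x) ?_ ?_ ?_
  · filter_upwards [h] with x hx
    exact neg_lt_neg_iff.1 hx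
  · have := hw.neg
    rw [neg_zero] at this
    refine this.congr fun x => ?_
    rw [integral_neg]; ring
  · simpa only [intervalIntegral.integral_neg, integral_neg] using hJ.neg
  · rw [neg_div]; exact neg_lt_neg ha

theorem MeasureTheory.integral_pos_of_ae_pos {α : Type*} [MeasurableSpace α] {μ : Measure α}
    [NeZero μ] {f : α → ℝ} (hf : Integrable f μ) (hpos : ∀ᵐ x ∂μ, 0 < f x) :
    0 < ∫ x, f x ∂μ := by
  rw [integral_pos_iff_support_of_nonneg_ae (hpos.mono fun x hx => hx.le) hf]
  have h : Function.support f ∈ ae μ := hpos.mono fun x hx => hx.ne'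
  rw [measure_eq_measure_of_null_sdiff (Set.subset_univ _) (by
    rw [← Set.compl_eq_univ_sdiff]; exact h)]
  exact Measure.measure_univ_pos.2 (NeZero.ne μ)

/-! ### Causal functions and convolution -/

/-- Measurable functions on `ℝ` that vanish on the negative half-line and are bounded on every
left half-line. -/
structure IsCausal (f : ℝ → ℝ) : Prop where
  measurable : Measurable f
  zero_of_neg : ∀ t < 0, f t = 0
  bounded : ∀ x, ∃ C, ∀ t ≤ x, |f t| ≤ C

namespace IsCausal

variable {f g : ℝ → ℝ}

theorem add (hf : IsCausal f) (hg : IsCausal g) : IsCausal fun t => f t + g t where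
  measurable := hf.measurable.add hg.measurable
  zero_of_neg t ht := by rw [hf.zero_of_neg t ht, hg.zero_of_neg t ht, add_zero]
  bounded x := by
    obtain ⟨C, hC⟩ := hf.bounded x
    obtain ⟨D, hD⟩ := hg.bounded x
    exact ⟨C + D, fun t ht => (abs_add_le _ _).trans (add_le_add (hC t ht) (hD t ht))⟩

theorem zero : IsCausal fun _ => 0 where
  measurable := measurable_const
  zero_of_neg _ _ := rfl
  bounded _ := ⟨0, fun _ _ => by simp⟩

theorem sum {ι : Type*} {f : ι → ℝ → ℝ} (hf : ∀ i, IsCausal (f i)) (s : Finset ι) :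
    IsCausal fun t => ∑ i ∈ s, f i t := by
  classical
  induction s using Finset.induction_on with
  | empty => simpa using zero
  | insert a s ha ih => simpa [Finset.sum_insert ha] using (hf a).add ih

theorem intervalIntegrable (hf : IsCausal f) (a b : ℝ) : IntervalIntegrable f volume a b := by
  obtain ⟨C, hC⟩ := hf.bounded (max a b)
  refine (intervalIntegrable_const (c := C)).mono_fun hf.measurable.aestronglyMeasurable ?_
  refine (ae_restrict_iff' measurableSet_uIoc).2 (Eventually.of_forall fun t ht => ?_)
  exact (hC t ht.2).trans (le_abs_self C)

theorem primitive_of_nonpos (hf : IsCausal f) {z : ℝ} (hz : z ≤ 0) :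
    ∫ t in (0 : ℝ)..z, f t = 0 := by
  rw [intervalIntegral.integral_of_ge hz, integral_Ioc_eq_integral_Ioo,
    setIntegral_eq_zero_of_forall_eq_zero fun t ht => hf.zero_of_neg t ht.2, neg_zero]

theorem continuous_primitive (hf : IsCausal f) : Continuous fun z => ∫ t in (0 : ℝ)..z, f t :=
  intervalIntegral.continuous_primitive hf.intervalIntegrable 0

theorem abs_primitive_le (hf : IsCausal f) {x C : ℝ} (hC : ∀ t ≤ x, |f t| ≤ C) {z : ℝ}
    (hz : z ≤ x) : |∫ t in (0 : ℝ)..z, f t| ≤ C * |x| := by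
  have hC0 : 0 ≤ C := (abs_nonneg _).trans (hC x le_rfl)
  rcases le_or_gt z 0 with h | h
  · rw [hf.primitive_of_nonpos h, abs_zero]; positivity
  · have := intervalIntegral.norm_integral_le_of_norm_le_const (a := 0) (b := z) (f := f)
      (C := C) fun t ht => hC t ((Set.uIoc_of_le h.le ▸ ht).2.trans hz)
    rw [sub_zero, abs_of_pos h] at this
    exact this.trans (mul_le_mul_of_nonneg_left (hz.trans (le_abs_self x)) hC0)

theorem primitive (hf : IsCausal f) : IsCausal fun z => ∫ t in (0 : ℝ)..z, f t where
  measurable := hf.continuous_primitive.measurable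
  zero_of_neg _ ht := hf.primitive_of_nonpos ht.le
  bounded x := by
    obtain ⟨C, hC⟩ := hf.bounded x
    exact ⟨C * |x|, fun z hz => hf.abs_primitive_le hC hz⟩

variable {F : Measure ℝ} [IsProbabilityMeasure F]

theorem integrable_sub (hf : IsCausal f) (hF0 : ∀ᵐ y ∂F, 0 ≤ y) (x : ℝ) :
    Integrable (fun y => f (x - y)) F := by
  obtain ⟨C, hC⟩ := hf.bounded x
  refine Integrable.of_bound
    (hf.measurable.comp (measurable_const.sub measurable_id)).aestronglyMeasurable C ?_
  filter_upwards [hF0] with y hy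
  exact hC _ (by linarith)

theorem abs_integral_sub_le (hF0 : ∀ᵐ y ∂F, 0 ≤ y) {x C : ℝ}
    (hC : ∀ t ≤ x, |f t| ≤ C) : |∫ y, f (x - y) ∂F| ≤ C := by
  have h := norm_integral_le_of_norm_le_const (μ := F) (f := fun y => f (x - y)) (C := C) (by
    filter_upwards [hF0] with y hy
    exact hC _ (by linarith))
  simpa using h

theorem conv (hf : IsCausal f) (hF0 : ∀ᵐ y ∂F, 0 ≤ y) :
    IsCausal fun t => ∫ y, f (t - y) ∂F where
  measurable := by
    have h : Measurable fun p : ℝ × ℝ => f (p.1 - p.2) :=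
      hf.measurable.comp (measurable_fst.sub measurable_snd)
    exact (h.stronglyMeasurable.integral_prod_right (ν := F)).measurable
  zero_of_neg t ht := by
    refine integral_eq_zero_of_ae ?_
    filter_upwards [hF0] with y hy
    exact hf.zero_of_neg _ (by linarith)
  bounded x := by
    obtain ⟨C, hC⟩ := hf.bounded x
    exact ⟨C, fun t ht => abs_integral_sub_le hF0 fun s hs => hC s (hs.trans ht)⟩

/-- Integration commutes with convolution. -/
theorem primitive_conv (hf : IsCausal f) (hF0 : ∀ᵐ y ∂F, 0 ≤ y) {x : ℝ} (hx : 0 ≤ x) :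
    ∫ t in (0 : ℝ)..x, (∫ y, f (t - y) ∂F) = ∫ y, (∫ t in (0 : ℝ)..(x - y), f t) ∂F := by
  obtain ⟨C, hC⟩ := hf.bounded x
  have hmeas : Measurable fun p : ℝ × ℝ => f (p.1 - p.2) :=
    hf.measurable.comp (measurable_fst.sub measurable_snd)
  rw [intervalIntegral.integral_of_le hx, integral_integral_swap]
  · refine integral_congr_ae ?_
    filter_upwards [hF0] with y hy
    -- After the shift the range is `[-y, x - y]`, and its part below 0 contributes nothing.
    rw [← intervalIntegral.integral_of_le hx, intervalIntegral.integral_comp_sub_right,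
      ← intervalIntegral.integral_add_adjacent_intervals (hf.intervalIntegrable _ 0)
        (hf.intervalIntegrable 0 _), intervalIntegral.integral_symm, zero_sub,
      hf.primitive_of_nonpos (neg_nonpos.2 hy), neg_zero, zero_add]
  · refine Integrable.of_bound hmeas.aestronglyMeasurable C ?_
    have h1 : ∀ᵐ p ∂((volume.restrict (Set.Ioc 0 x)).prod F), p.1 ∈ Set.Ioc 0 x :=
      Measure.quasiMeasurePreserving_fst.ae (ae_restrict_mem measurableSet_Ioc)
    have h2 : ∀ᵐ p ∂((volume.restrict (Set.Ioc 0 x)).prod F), 0 ≤ p.2 :=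
      Measure.quasiMeasurePreserving_snd.ae hF0
    filter_upwards [h1, h2] with p hp1 hp2
    exact hC _ (by linarith [hp1.2])

/-- The averages of `f` over windows `[x - y, x]` in terms of the defect of `f` in the renewal
equation. -/
theorem integral_window (hf : IsCausal f) (hF0 : ∀ᵐ y ∂F, 0 ≤ y) {x : ℝ} (hx : 0 ≤ x) :
    ∫ y, (∫ s in (0 : ℝ)..y, f (x - s)) ∂F
      = ∫ t in (0 : ℝ)..x, (f t - ∫ y, f (t - y) ∂F) := by
  rw [intervalIntegral.integral_sub (hf.intervalIntegrable _ _)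
    ((hf.conv hF0).intervalIntegrable _ _), hf.primitive_conv hF0 hx]
  have h : ∀ y, ∫ s in (0 : ℝ)..y, f (x - s)
      = (∫ t in (0 : ℝ)..x, f t) - ∫ t in (0 : ℝ)..(x - y), f t := by
    intro y
    rw [intervalIntegral.integral_comp_sub_left, sub_zero,
      intervalIntegral.integral_interval_sub_left (hf.intervalIntegrable _ _)
        (hf.intervalIntegrable _ _)]
  simp_rw [h]
  rw [integral_sub (integrable_const _) (hf.primitive.integrable_sub hF0 x)]
  simp

end IsCausal

/-! ### The renewal density and its uniform bound -/

/-- The density of the standard exponential law. -/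
noncomputable def expDensity (t : ℝ) : ℝ := if 0 ≤ t then Real.exp (-t) else 0

theorem expDensity_nonneg (t : ℝ) : 0 ≤ expDensity t := by
  unfold expDensity; split_ifs <;> positivity

theorem expDensity_le_one (t : ℝ) : expDensity t ≤ 1 := by
  unfold expDensity; split_ifs with h
  · exact Real.exp_le_one_iff.2 (by linarith)
  · exact zero_le_one

theorem isCausal_expDensity : IsCausal expDensity where
  measurable := Measurable.ite measurableSet_Ici (by fun_prop) measurable_const
  zero_of_neg t ht := if_neg (not_le.2 ht)
  bounded x := ⟨1, fun t _ => by
    rw [abs_of_nonneg (expDensity_nonneg t)]; exact expDensity_le_one t⟩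

theorem integral_expDensity (z : ℝ) :
    ∫ t in (0 : ℝ)..z, expDensity t = 1 - Real.exp (-max z 0) := by
  rcases le_total z 0 with h | h
  · rw [isCausal_expDensity.primitive_of_nonpos h, max_eq_right h]; simp
  · rw [max_eq_left h]
    have : ∫ t in (0 : ℝ)..z, expDensity t = ∫ t in (0 : ℝ)..z, Real.exp (-t) :=
      intervalIntegral.integral_congr fun t ht => if_pos (Set.uIcc_of_le h ▸ ht).1
    rw [this]; simp

/-- The sequence of iterated convolutions `n k = F^{*k} * n 0` of the exponential density. -/
structure IsRenewalSeq (F : Measure ℝ) (n : ℕ → ℝ → ℝ) : Prop where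
  zero : ∀ t, n 0 t = expDensity t
  succ : ∀ k t, n (k + 1) t = ∫ y, n k (t - y) ∂F
  mono : ∀ k, Monotone fun t => Real.exp t * n k t

namespace IsRenewalSeq

variable {F : Measure ℝ} {n : ℕ → ℝ → ℝ}

theorem nonneg (hn : IsRenewalSeq F n) (k : ℕ) (t : ℝ) : 0 ≤ n k t := by
  induction k generalizing t with
  | zero => rw [hn.zero]; exact expDensity_nonneg t
  | succ k ih => rw [hn.succ]; exact integral_nonneg fun y => ih _

variable [IsProbabilityMeasure F]

theorem isCausal (hn : IsRenewalSeq F n) (hF0 : ∀ᵐ y ∂F, 0 ≤ y) (k : ℕ) : IsCausal (n k) := by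
  induction k with
  | zero => rw [show n 0 = expDensity from funext hn.zero]; exact isCausal_expDensity
  | succ k ih =>
    rw [show n (k + 1) = _ from funext (hn.succ k)]; exact ih.conv hF0

theorem integral_one (hn : IsRenewalSeq F n) (hF0 : ∀ᵐ y ∂F, 0 ≤ y) {x : ℝ} (hx : 0 ≤ x) :
    ∫ t in (0 : ℝ)..x, n 1 t = ∫ y, (1 - Real.exp (-max (x - y) 0)) ∂F := by
  simp_rw [show n 1 = _ from funext (hn.succ 0), (hn.isCausal hF0 0).primitive_conv hF0 hx,
    hn.zero, integral_expDensity]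

/-- Convolution with `F` raises the index by one, so the difference telescopes. -/
theorem partial_sub_conv (hn : IsRenewalSeq F n) (hF0 : ∀ᵐ y ∂F, 0 ≤ y) (m : ℕ) (t : ℝ) :
    ∑ k ∈ Finset.range m, n (k + 1) t - ∫ y, (∑ k ∈ Finset.range m, n (k + 1) (t - y)) ∂F
      = n 1 t - n (m + 1) t := by
  rw [integral_finsetSum _ fun k _ => (hn.isCausal hF0 (k + 1)).integrable_sub hF0 t]
  simp_rw [← hn.succ]
  rw [← Finset.sum_sub_distrib, Finset.sum_range_sub' (fun k => n (k + 1) t)]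

/-- The partial sums of the renewal density are uniformly bounded. -/
theorem exists_partial_le (hn : IsRenewalSeq F n) (hF : ∀ᵐ y ∂F, 0 < y) :
    ∃ C, ∀ m t, ∑ k ∈ Finset.range m, n (k + 1) t ≤ C := by
  have hF0 : ∀ᵐ y ∂F, 0 ≤ y := hF.mono fun y hy => hy.le
  have hminb : ∀ᵐ y ∂F, ‖min y 1‖ ≤ 1 := by
    filter_upwards [hF] with y hy
    rw [Real.norm_eq_abs, abs_of_nonneg (le_min hy.le zero_le_one)]
    exact min_le_right _ _
  have hmini : Integrable (fun y : ℝ => min y 1) F :=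
    Integrable.of_bound (by fun_prop : Continuous fun y : ℝ => min y 1).aestronglyMeasurable 1 hminb
  have hκ : 0 < ∫ y, min y 1 ∂F :=
    integral_pos_of_ae_pos hmini (hF.mono fun y hy => lt_min hy one_pos)
  set κ := ∫ y, min y 1 ∂F with hκdef
  -- Monotonicity of `e^t v(t)` gives `v ≥ e^{-1} v(s)` on `[s, s + 1]`. A window of length `y`
  -- ending at `s + 1` thus contributes at least `min y 1 * e^{-1} v(s)`, while the average over
  -- windows is at most `∫ n 1 ≤ 1`.
  refine ⟨Real.exp 1 / κ, fun m s => ?_⟩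
  set v : ℝ → ℝ := fun t => ∑ k ∈ Finset.range m, n (k + 1) t with hv
  have hvc : IsCausal v := IsCausal.sum (fun k => hn.isCausal hF0 (k + 1)) _
  have hv0 : ∀ t, 0 ≤ v t := fun t => Finset.sum_nonneg fun k _ => hn.nonneg _ _
  have hvmono : Monotone fun t => Real.exp t * v t := by
    intro a b hab
    simp only [hv, Finset.mul_sum]
    exact Finset.sum_le_sum fun k _ => hn.mono (k + 1) hab
  show v s ≤ _
  rcases lt_or_ge s 0 with hs | hs
  · rw [hvc.zero_of_neg s hs]; positivity
  have hx : 0 ≤ s + 1 := by linarith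
  have hwin := hvc.integral_window hF0 hx
  have hle : ∫ t in (0 : ℝ)..(s + 1), (v t - ∫ y, v (t - y) ∂F) ≤ 1 := by
    calc ∫ t in (0 : ℝ)..(s + 1), (v t - ∫ y, v (t - y) ∂F)
        ≤ ∫ t in (0 : ℝ)..(s + 1), n 1 t := by
          refine intervalIntegral.integral_mono hx ((hvc.intervalIntegrable _ _).sub
            ((hvc.conv hF0).intervalIntegrable _ _))
            ((hn.isCausal hF0 1).intervalIntegrable _ _) fun t => ?_
          have := hn.partial_sub_conv hF0 m t
          have := hn.nonneg (m + 1) t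
          simp only [hv]
          linarith
      _ ≤ 1 := by
          rw [hn.integral_one hF0 hx]
          calc _ ≤ ∫ _, (1 : ℝ) ∂F := by
                refine integral_mono_of_nonneg (Eventually.of_forall fun y => ?_)
                  (integrable_const _) (Eventually.of_forall fun y => ?_)
                · have := Real.exp_le_one_iff.2 (neg_nonpos.2 (le_max_right (s + 1 - y) 0))
                  simpa only [Pi.zero_apply, sub_nonneg] using this
                · have := Real.exp_pos (-max (s + 1 - y) 0)
                  show 1 - _ ≤ (1 : ℝ)
                  linarith
            _ = 1 := by simp
  have hge : κ * (Real.exp (-1) * v s) ≤ ∫ y, (∫ r in (0 : ℝ)..y, v (s + 1 - r)) ∂F := by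
    rw [hκdef, ← integral_mul_const]
    have hprim : ∀ y, ∫ r in (0 : ℝ)..y, v (s + 1 - r)
        = (∫ t in (0 : ℝ)..(s + 1), v t) - ∫ t in (0 : ℝ)..(s + 1 - y), v t := by
      intro y
      rw [intervalIntegral.integral_comp_sub_left, sub_zero,
        intervalIntegral.integral_interval_sub_left (hvc.intervalIntegrable _ _)
          (hvc.intervalIntegrable _ _)]
    have hrefl : ∀ a b, IntervalIntegrable (fun r => v (s + 1 - r)) volume a b := by
      intro a b
      have := (hvc.intervalIntegrable (s + 1 - a) (s + 1 - b)).comp_sub_left (s + 1)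
      simpa using this
    refine integral_mono_ae (hmini.mul_const _) ?_ ?_
    · simp_rw [hprim]
      exact (integrable_const _).sub (hvc.primitive.integrable_sub hF0 _)
    · filter_upwards [hF0] with y hy
      have hm : (0 : ℝ) ≤ min y 1 := le_min hy zero_le_one
      calc min y 1 * (Real.exp (-1) * v s)
          = ∫ r in (0 : ℝ)..(min y 1), Real.exp (-1) * v s := by
            rw [intervalIntegral.integral_const, sub_zero, smul_eq_mul]
        _ ≤ ∫ r in (0 : ℝ)..(min y 1), v (s + 1 - r) := by
            refine intervalIntegral.integral_mono_on hm intervalIntegrable_const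
              (hrefl _ _) fun r hr => ?_
            have hr1 : r ≤ 1 := hr.2.trans (min_le_right _ _)
            have h1 : Real.exp s * v s ≤ Real.exp (s + 1 - r) * v (s + 1 - r) :=
              hvmono (by linarith)
            have h2 : Real.exp (s + 1 - r) * v (s + 1 - r) ≤ Real.exp (s + 1) * v (s + 1 - r) :=
              mul_le_mul_of_nonneg_right (Real.exp_le_exp.2 (by linarith [hr.1])) (hv0 _)
            have h3 := h1.trans h2
            have h4 : Real.exp (-1) * v s = Real.exp (-(s + 1)) * (Real.exp s * v s) := by
              rw [← mul_assoc, ← Real.exp_add]; congr 2; ring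
            have h5 : v (s + 1 - r)
                = Real.exp (-(s + 1)) * (Real.exp (s + 1) * v (s + 1 - r)) := by
              rw [← mul_assoc, ← Real.exp_add]; simp
            rw [h4, h5]
            exact mul_le_mul_of_nonneg_left h3 (Real.exp_pos _).le
        _ ≤ ∫ r in (0 : ℝ)..y, v (s + 1 - r) := by
            refine intervalIntegral.integral_mono_interval le_rfl hm (min_le_left _ _)
              (Eventually.of_forall fun r => hv0 _) (hrefl _ _)
  rw [hwin] at hge
  have h6 := hge.trans hle
  rw [Real.exp_neg] at h6
  rw [le_div_iff₀ hκ]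
  have h7 : κ * ((Real.exp 1)⁻¹ * v s) * Real.exp 1 = v s * κ := by
    field_simp
  have h8 := mul_le_mul_of_nonneg_right h6 (Real.exp_pos 1).le
  rw [h7] at h8
  linarith

theorem summable (hn : IsRenewalSeq F n) (hF : ∀ᵐ y ∂F, 0 < y) (t : ℝ) :
    Summable fun k => n (k + 1) t := by
  obtain ⟨C, hC⟩ := hn.exists_partial_le hF
  exact summable_of_sum_range_le (fun k => hn.nonneg _ _) fun m => hC m t

theorem exists_tsum_le (hn : IsRenewalSeq F n) (hF : ∀ᵐ y ∂F, 0 < y) :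
    ∃ C, ∀ t, |∑' k, n (k + 1) t| ≤ C := by
  obtain ⟨C, hC⟩ := hn.exists_partial_le hF
  refine ⟨C, fun t => ?_⟩
  rw [abs_of_nonneg (tsum_nonneg fun k => hn.nonneg _ _)]
  exact Real.tsum_le_of_sum_range_le (fun k => hn.nonneg _ _) fun m => hC m t

theorem isCausal_tsum (hn : IsRenewalSeq F n) (hF : ∀ᵐ y ∂F, 0 < y) :
    IsCausal fun t => ∑' k, n (k + 1) t where
  measurable := by
    have hF0 : ∀ᵐ y ∂F, 0 ≤ y := hF.mono fun y hy => hy.le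
    refine measurable_of_tendsto_metrizable
      (f := fun m t => ∑ k ∈ Finset.range m, n (k + 1) t) (fun m =>
        (IsCausal.sum (fun k => hn.isCausal hF0 (k + 1)) _).measurable) ?_
    exact tendsto_pi_nhds.2 fun t => (hn.summable hF t).hasSum.tendsto_sum_nat
  zero_of_neg t ht := by
    have hF0 : ∀ᵐ y ∂F, 0 ≤ y := hF.mono fun y hy => hy.le
    simp [(hn.isCausal hF0 _).zero_of_neg t ht]
  bounded x := by
    obtain ⟨C, hC⟩ := hn.exists_tsum_le hF
    exact ⟨C, fun t _ => hC t⟩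

/-- The renewal equation. -/
theorem tsum_sub_conv (hn : IsRenewalSeq F n) (hF : ∀ᵐ y ∂F, 0 < y) (t : ℝ) :
    ∑' k, n (k + 1) t - ∫ y, (∑' k, n (k + 1) (t - y)) ∂F = n 1 t := by
  have hF0 : ∀ᵐ y ∂F, 0 ≤ y := hF.mono fun y hy => hy.le
  obtain ⟨C, hC⟩ := hn.exists_partial_le hF
  have h1 : Tendsto (fun m => ∑ k ∈ Finset.range m, n (k + 1) t
      - ∫ y, (∑ k ∈ Finset.range m, n (k + 1) (t - y)) ∂F) atTop
      (𝓝 (∑' k, n (k + 1) t - ∫ y, (∑' k, n (k + 1) (t - y)) ∂F)) := by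
    refine (hn.summable hF t).hasSum.tendsto_sum_nat.sub ?_
    refine tendsto_integral_of_dominated_convergence (fun _ => C) (fun m => ?_)
      (integrable_const _) (fun m => Eventually.of_forall fun y => ?_)
      (Eventually.of_forall fun y => (hn.summable hF (t - y)).hasSum.tendsto_sum_nat)
    · exact ((IsCausal.sum (fun k => hn.isCausal hF0 (k + 1)) _).integrable_sub hF0
        t).aestronglyMeasurable
    · rw [Real.norm_eq_abs, abs_of_nonneg (Finset.sum_nonneg fun k _ => hn.nonneg _ _)]
      exact hC m _
  have h2 : Tendsto (fun m => n 1 t - n (m + 1) t) atTop (𝓝 (n 1 t - 0)) :=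
    tendsto_const_nhds.sub (hn.summable hF t).tendsto_atTop_zero
  rw [sub_zero] at h2
  exact tendsto_nhds_unique (h1.congr fun m => hn.partial_sub_conv hF0 m t) h2

end IsRenewalSeq

/-! ### The explicit defect -/

theorem integral_exp_neg_max (z : ℝ) :
    ∫ s in (0 : ℝ)..z, Real.exp (-max s 0) = 1 - Real.exp (-max z 0) + min z 0 := by
  rcases le_total z 0 with h | h
  · have : ∫ s in (0 : ℝ)..z, Real.exp (-max s 0) = ∫ s in (0 : ℝ)..z, (1 : ℝ) :=
      intervalIntegral.integral_congr fun t ht => by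
        have := (Set.uIcc_of_ge h ▸ ht).2
        simp [max_eq_right this]
    rw [this, max_eq_right h, min_eq_left h]; simp
  · have : ∫ s in (0 : ℝ)..z, Real.exp (-max s 0) = ∫ s in (0 : ℝ)..z, Real.exp (-s) :=
      intervalIntegral.integral_congr fun t ht => by
        have := (Set.uIcc_of_le h ▸ ht).1
        simp only [max_eq_left this]
    rw [this, max_eq_left h, min_eq_right h]; simp

theorem integral_max_zero (z : ℝ) :
    ∫ s in (0 : ℝ)..z, max s 0 = max z 0 ^ 2 / 2 := by
  rcases le_total z 0 with h | h
  · have : ∫ s in (0 : ℝ)..z, max s 0 = ∫ s in (0 : ℝ)..z, (0 : ℝ) :=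
      intervalIntegral.integral_congr fun t ht => by
        have := (Set.uIcc_of_ge h ▸ ht).2
        simp [max_eq_right this]
    rw [this, max_eq_right h]; simp
  · have : ∫ s in (0 : ℝ)..z, max s 0 = ∫ s in (0 : ℝ)..z, s :=
      intervalIntegral.integral_congr fun t ht => by
        have := (Set.uIcc_of_le h ▸ ht).1
        simp only [max_eq_left this]
    rw [this, max_eq_left h]; simp

/-- The defect of `x ↦ ∫ t in 0..x, (u t - 1 / μ)` in the renewal equation at time `t`, for a step
of length `y`. -/
noncomputable def stepDefect (μ t y : ℝ) : ℝ := max (y - t) 0 / μ - Real.exp (-max (t - y) 0)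

theorem abs_stepDefect_le {μ t y : ℝ} (hμ : 0 < μ) (ht : 0 ≤ t) (hy : 0 ≤ y) :
    |stepDefect μ t y| ≤ y / μ + 1 := by
  have h1 : max (y - t) 0 / μ ≤ y / μ :=
    div_le_div_of_nonneg_right (max_le (by linarith) hy) hμ.le
  have h2 : 0 ≤ max (y - t) 0 / μ := div_nonneg (le_max_right _ _) hμ.le
  have h3 := Real.exp_pos (-max (t - y) 0)
  have h4 := Real.exp_le_one_iff.2 (neg_nonpos.2 (le_max_right (t - y) 0))
  unfold stepDefect
  exact abs_le.2 ⟨by linarith, by linarith⟩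

theorem continuous_stepDefect (μ : ℝ) : Continuous fun p : ℝ × ℝ => stepDefect μ p.1 p.2 := by
  unfold stepDefect; fun_prop

theorem integral_stepDefect (μ x : ℝ) {y : ℝ} (hy : 0 ≤ y) :
    ∫ t in (0 : ℝ)..x, stepDefect μ t y = (y ^ 2 - max (y - x) 0 ^ 2) / (2 * μ)
      - (1 - Real.exp (-max (x - y) 0) + min (x - y) 0 + y) := by
  have hc1 : Continuous fun s : ℝ => max s 0 := by fun_prop
  have hc2 : Continuous fun s : ℝ => Real.exp (-max s 0) := by fun_prop
  unfold stepDefect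
  rw [intervalIntegral.integral_sub (Continuous.intervalIntegrable (by fun_prop) _ _)
    (Continuous.intervalIntegrable (by fun_prop) _ _), intervalIntegral.integral_div,
    intervalIntegral.integral_comp_sub_left (fun s => max s 0),
    intervalIntegral.integral_comp_sub_right (fun s => Real.exp (-max s 0)), sub_zero, zero_sub,
    ← intervalIntegral.integral_interval_sub_left (hc1.intervalIntegrable 0 _)
      (hc1.intervalIntegrable 0 _),
    ← intervalIntegral.integral_interval_sub_left (hc2.intervalIntegrable 0 _)
      (hc2.intervalIntegrable 0 _), integral_max_zero, integral_max_zero, integral_exp_neg_max,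
    integral_exp_neg_max, max_eq_left hy, max_eq_right (neg_nonpos.2 hy),
    min_eq_left (neg_nonpos.2 hy)]
  simp only [neg_zero, Real.exp_zero, sub_self, zero_add, sub_neg_eq_add]
  congr 1
  rw [← sub_div, div_div]

/-- This domination is uniform in `x` and quadratic in `y`; it is why a second moment of `F` is
needed. -/
theorem abs_integral_stepDefect_le {μ x y : ℝ} (hμ : 0 < μ) (hx : 0 ≤ x) (hy : 0 ≤ y) :
    |∫ t in (0 : ℝ)..x, stepDefect μ t y| ≤ y ^ 2 / (2 * μ) + y + 1 := by
  rw [integral_stepDefect μ x hy]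
  have h1 : (y ^ 2 - max (y - x) 0 ^ 2) / (2 * μ) ≤ y ^ 2 / (2 * μ) :=
    div_le_div_of_nonneg_right (by nlinarith [sq_nonneg (max (y - x) 0)]) (by positivity)
  have h2 : 0 ≤ (y ^ 2 - max (y - x) 0 ^ 2) / (2 * μ) := by
    refine div_nonneg (sub_nonneg.2 ?_) (by positivity)
    exact pow_le_pow_left₀ (le_max_right _ _) (max_le (by linarith) hy) 2
  have h3 := Real.exp_pos (-max (x - y) 0)
  have h4 := Real.exp_le_one_iff.2 (neg_nonpos.2 (le_max_right (x - y) 0))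
  have h5 : min (x - y) 0 ≤ 0 := min_le_right _ _
  have h6 : -y ≤ min (x - y) 0 := le_min (by linarith) (by linarith)
  have h7 : 0 ≤ y ^ 2 / (2 * μ) := by positivity
  exact abs_le.2 ⟨by linarith, by linarith⟩

/-- The ramp `(y - t)⁺` has area `y² / 2`; the exponential term contributes `y` before time `y` and
1 after it. -/
theorem tendsto_integral_stepDefect (μ : ℝ) {y : ℝ} (hy : 0 ≤ y) :
    Tendsto (fun x => ∫ t in (0 : ℝ)..x, stepDefect μ t y) atTop
      (𝓝 (y ^ 2 / (2 * μ) - (1 + y))) := by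
  have h0 : Tendsto (fun x : ℝ => Real.exp (-(x - y))) atTop (𝓝 0) :=
    Real.tendsto_exp_neg_atTop_nhds_zero.comp (tendsto_atTop_add_const_right _ (-y) tendsto_id)
  have h1 : Tendsto (fun x : ℝ => y ^ 2 / (2 * μ) - (1 - Real.exp (-(x - y)) + y)) atTop
      (𝓝 (y ^ 2 / (2 * μ) - (1 - 0 + y))) :=
    tendsto_const_nhds.sub ((tendsto_const_nhds.sub h0).add_const y)
  rw [sub_zero] at h1
  refine h1.congr' ?_
  filter_upwards [eventually_ge_atTop y] with x hx
  rw [integral_stepDefect μ x hy, max_eq_right (by linarith), max_eq_left (by linarith),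
    min_eq_right (by linarith)]
  ring

theorem tendsto_stepDefect (μ y : ℝ) :
    Tendsto (fun t => stepDefect μ t y) atTop (𝓝 0) := by
  have h0 : Tendsto (fun x : ℝ => Real.exp (-(x - y))) atTop (𝓝 0) :=
    Real.tendsto_exp_neg_atTop_nhds_zero.comp (tendsto_atTop_add_const_right _ (-y) tendsto_id)
  have h1 := h0.neg
  rw [neg_zero] at h1
  refine h1.congr' ?_
  filter_upwards [eventually_ge_atTop y] with x hx
  unfold stepDefect
  rw [max_eq_right (by linarith), max_eq_left (by linarith)]
  ring

/-! ### The centred primitive and its limit -/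

section Centred

variable {u : ℝ → ℝ} {μ : ℝ}

/-- The centred primitive of a renewal density `u`. -/
noncomputable def centredPrimitive (u : ℝ → ℝ) (μ x : ℝ) : ℝ :=
  (∫ t in (0 : ℝ)..x, u t) - max x 0 / μ

theorem lipschitzWith_centredPrimitive (hu : IsCausal u) {C : ℝ} (hC : ∀ t, |u t| ≤ C) :
    LipschitzWith (C + |μ⁻¹|).toNNReal (centredPrimitive u μ) := by
  have hC0 : 0 ≤ C := (abs_nonneg _).trans (hC 0)
  refine LipschitzWith.of_dist_le_mul fun x y => ?_
  rw [Real.coe_toNNReal _ (by positivity), Real.dist_eq, Real.dist_eq]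
  have h1 : centredPrimitive u μ x - centredPrimitive u μ y
      = (∫ t in y..x, u t) - μ⁻¹ * (max x 0 - max y 0) := by
    unfold centredPrimitive
    rw [← intervalIntegral.integral_interval_sub_left (hu.intervalIntegrable 0 x)
      (hu.intervalIntegrable 0 y)]
    ring
  rw [h1]
  refine (abs_sub _ _).trans ?_
  rw [add_mul, abs_mul]
  refine add_le_add ?_ ?_
  · exact intervalIntegral.norm_integral_le_of_norm_le_const (f := u) fun t _ => hC t
  · exact mul_le_mul_of_nonneg_left (abs_max_sub_max_le_abs x y 0) (abs_nonneg _)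

theorem isCausal_max_zero : IsCausal fun x => max x 0 where
  measurable := by fun_prop
  zero_of_neg t ht := max_eq_right ht.le
  bounded x := ⟨max x 0, fun t ht => by
    rw [abs_of_nonneg (le_max_right _ _)]; exact max_le_max ht le_rfl⟩

theorem isCausal_centredPrimitive (hu : IsCausal u) : IsCausal (centredPrimitive u μ) where
  measurable := hu.primitive.measurable.sub (isCausal_max_zero.measurable.div_const μ)
  zero_of_neg t ht := by
    simp [centredPrimitive, hu.primitive_of_nonpos ht.le, max_eq_right ht.le]
  bounded x := by
    obtain ⟨C, hC⟩ := hu.primitive.bounded x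
    obtain ⟨D, hD⟩ := isCausal_max_zero.bounded x
    refine ⟨C + D / |μ|, fun t ht => (abs_sub _ _).trans (add_le_add (hC t ht) ?_)⟩
    rw [abs_div]
    exact div_le_div_of_nonneg_right (hD t ht) (abs_nonneg _)

end Centred

namespace IsRenewalSeq

variable {F : Measure ℝ} [IsProbabilityMeasure F] {n : ℕ → ℝ → ℝ}

/-- Integrating the renewal equation gives the defect of the primitive of `u`; that of `max x 0 / μ`
is computed directly. -/
theorem centredPrimitive_sub_conv (hn : IsRenewalSeq F n) (hF : ∀ᵐ y ∂F, 0 < y)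
    (hFi : Integrable (fun y => y) F) (hμ : 0 < ∫ y, y ∂F) {x : ℝ} (hx : 0 ≤ x) :
    centredPrimitive (fun t => ∑' k, n (k + 1) t) (∫ y, y ∂F) x
      - ∫ y, centredPrimitive (fun t => ∑' k, n (k + 1) t) (∫ y, y ∂F) (x - y) ∂F
      = ∫ y, stepDefect (∫ y, y ∂F) x y ∂F := by
  have hF0 : ∀ᵐ y ∂F, 0 ≤ y := hF.mono fun y hy => hy.le
  set μ := ∫ y, y ∂F with hμdef
  have hu := hn.isCausal_tsum hF
  have hi1 := hu.primitive.integrable_sub hF0 x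
  have hi2 : Integrable (fun y => max (x - y) 0 / μ) F :=
    (isCausal_max_zero.integrable_sub hF0 x).div_const μ
  have hi3 : Integrable (fun y => 1 - Real.exp (-max (x - y) 0)) F := by
    refine Integrable.of_bound (by fun_prop : Continuous fun y =>
      1 - Real.exp (-max (x - y) 0)).aestronglyMeasurable 1 (Eventually.of_forall fun y => ?_)
    have h1 := Real.exp_pos (-max (x - y) 0)
    have h2 := Real.exp_le_one_iff.2 (neg_nonpos.2 (le_max_right (x - y) 0))
    exact abs_le.2 ⟨by linarith, by linarith⟩
  have hΦ : (∫ t in (0 : ℝ)..x, ∑' k, n (k + 1) t)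
      - ∫ y, (∫ t in (0 : ℝ)..(x - y), ∑' k, n (k + 1) t) ∂F
      = ∫ y, (1 - Real.exp (-max (x - y) 0)) ∂F := by
    rw [← hu.primitive_conv hF0 hx, ← intervalIntegral.integral_sub
      (hu.intervalIntegrable _ _) ((hu.conv hF0).intervalIntegrable _ _), ← hn.integral_one hF0 hx]
    exact intervalIntegral.integral_congr fun t _ => hn.tsum_sub_conv hF t
  unfold centredPrimitive
  rw [integral_sub hi1 hi2]
  -- The extra term `y / μ - 1` has mean zero under `F`; with it the integrand itself decays as `x →
  -- ∞` for each fixed `y`.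
  have hstep : ∀ y, stepDefect μ x y = (1 - Real.exp (-max (x - y) 0)) + max (x - y) 0 / μ
      - x / μ + (y / μ - 1) := by
    intro y
    have : max (y - x) 0 = max (x - y) 0 + (y - x) := by
      rcases le_total x y with h | h
      · rw [max_eq_left (by linarith), max_eq_right (by linarith)]; ring
      · rw [max_eq_right (by linarith), max_eq_left (by linarith)]; ring
    unfold stepDefect
    rw [this]; ring
  simp_rw [hstep]
  have hi4 : Integrable (fun y => y / μ - 1) F := (hFi.div_const μ).sub (integrable_const 1)
  have hone : ∫ y, y / μ ∂F = 1 := by rw [integral_div, ← hμdef, div_self hμ.ne']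
  have hi5 : Integrable (fun y => 1 - Real.exp (-max (x - y) 0) + max (x - y) 0 / μ) F :=
    hi3.add hi2
  have hi6 : Integrable
      (fun y => 1 - Real.exp (-max (x - y) 0) + max (x - y) 0 / μ - x / μ) F :=
    hi5.sub (integrable_const _)
  rw [integral_add hi6 hi4, integral_sub hi5 (integrable_const _), integral_add hi3 hi2,
    integral_sub (hFi.div_const μ) (integrable_const 1), hone, max_eq_left hx]
  simp only [integral_const, probReal_univ, smul_eq_mul]
  linarith

/-- The averages of the centred primitive of the renewal density. -/
theorem integral_window_centredPrimitive (hn : IsRenewalSeq F n) (hF : ∀ᵐ y ∂F, 0 < y)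
    (hFi : Integrable (fun y => y) F) (hμ : 0 < ∫ y, y ∂F) {x : ℝ} (hx : 0 ≤ x) :
    ∫ y, (∫ s in (0 : ℝ)..y,
      centredPrimitive (fun t => ∑' k, n (k + 1) t) (∫ y, y ∂F) (x - s)) ∂F
      = ∫ y, (∫ t in (0 : ℝ)..x, stepDefect (∫ y, y ∂F) t y) ∂F := by
  have hF0 : ∀ᵐ y ∂F, 0 ≤ y := hF.mono fun y hy => hy.le
  rw [(isCausal_centredPrimitive (hn.isCausal_tsum hF)).integral_window hF0 hx]
  set μ := ∫ y, y ∂F with hμdef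
  rw [intervalIntegral.integral_congr (g := fun t => ∫ y, stepDefect μ t y ∂F) fun t ht =>
    hn.centredPrimitive_sub_conv hF hFi hμ (Set.uIcc_of_le hx ▸ ht).1]
  simp_rw [intervalIntegral.integral_of_le hx]
  refine integral_integral_swap ?_
  refine Integrable.mono' (((hFi.div_const μ).add (integrable_const 1)).comp_snd _)
    (continuous_stepDefect μ).aestronglyMeasurable ?_
  have h1 : ∀ᵐ p ∂((volume.restrict (Set.Ioc 0 x)).prod F), p.1 ∈ Set.Ioc 0 x :=
    Measure.quasiMeasurePreserving_fst.ae (ae_restrict_mem measurableSet_Ioc)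
  have h2 : ∀ᵐ p ∂((volume.restrict (Set.Ioc 0 x)).prod F), 0 ≤ p.2 :=
    Measure.quasiMeasurePreserving_snd.ae hF0
  filter_upwards [h1, h2] with p hp1 hp2
  exact abs_stepDefect_le hμ hp1.1.le hp2

/-- The second order asymptotics of the integrated renewal density. -/
theorem tendsto_centredPrimitive (hn : IsRenewalSeq F n) (hF : ∀ᵐ y ∂F, 0 < y)
    (hFi : Integrable (fun y => y) F) (hF2 : Integrable (fun y => y ^ 2) F)
    (hμ : 0 < ∫ y, y ∂F) (hdense : Dense (AddSubgroup.closure F.support : Set ℝ)) :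
    Tendsto (centredPrimitive (fun t => ∑' k, n (k + 1) t) (∫ y, y ∂F)) atTop
      (𝓝 (((∫ y, y ^ 2 ∂F) / (2 * ∫ y, y ∂F) - (1 + ∫ y, y ∂F)) / ∫ y, y ∂F)) := by
  have hF0 : ∀ᵐ y ∂F, 0 ≤ y := hF.mono fun y hy => hy.le
  set μ := ∫ y, y ∂F with hμdef
  obtain ⟨C, hC⟩ := hn.exists_tsum_le hF
  have hu := hn.isCausal_tsum hF
  set W := centredPrimitive (fun t => ∑' k, n (k + 1) t) μ with hWdef
  have hWc : IsCausal W := isCausal_centredPrimitive hu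
  have hLip : LipschitzWith (C + |μ⁻¹|).toNNReal W := lipschitzWith_centredPrimitive hu hC
  set K := (C + |μ⁻¹|).toNNReal
  have hdom : Integrable (fun y => y ^ 2 / (2 * μ) + y + 1) F :=
    ((hF2.div_const _).add hFi).add (integrable_const _)
  have hdefect : ∀ x ≥ 0, ∫ y, (∫ s in (0 : ℝ)..y, W (x - s)) ∂F
      = ∫ y, (∫ t in (0 : ℝ)..x, stepDefect μ t y) ∂F := fun x hx =>
    hn.integral_window_centredPrimitive hF hFi hμ hx
  have hJ : Tendsto (fun x => ∫ y, (∫ s in (0 : ℝ)..y, W (x - s)) ∂F) atTop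
      (𝓝 (∫ y, (y ^ 2 / (2 * μ) - (1 + y)) ∂F)) := by
    have h : Tendsto (fun x => ∫ y, (∫ t in (0 : ℝ)..x, stepDefect μ t y) ∂F) atTop
        (𝓝 (∫ y, (y ^ 2 / (2 * μ) - (1 + y)) ∂F)) := by
      refine tendsto_integral_filter_of_dominated_convergence _
        (Eventually.of_forall fun x => ?_) ?_ hdom ?_
      · exact (intervalIntegral.continuous_parametric_intervalIntegral_of_continuous'
          (f := fun y t => stepDefect μ t y)
          ((continuous_stepDefect μ).comp continuous_swap) 0 x).aestronglyMeasurable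
      · filter_upwards [eventually_ge_atTop 0] with x hx
        filter_upwards [hF0] with y hy
        exact abs_integral_stepDefect_le hμ hx hy
      · filter_upwards [hF0] with y hy
        exact tendsto_integral_stepDefect μ hy
    refine h.congr' ?_
    filter_upwards [eventually_ge_atTop 0] with x hx
    exact (hdefect x hx).symm
  have hc : ∫ y, (y ^ 2 / (2 * μ) - (1 + y)) ∂F = (∫ y, y ^ 2 ∂F) / (2 * μ) - (1 + μ) := by
    have hi : Integrable (fun y : ℝ => 1 + y) F := (integrable_const _).add hFi
    rw [integral_sub (hF2.div_const _) hi, integral_div,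
      integral_add (integrable_const _) hFi]
    simp [hμdef]
  rw [hc] at hJ
  have hw : Tendsto (fun x => W x - ∫ y, W (x - y) ∂F) atTop (𝓝 0) := by
    have h : Tendsto (fun x => ∫ y, stepDefect μ x y ∂F) atTop (𝓝 (∫ _, 0 ∂F)) := by
      refine tendsto_integral_filter_of_dominated_convergence (fun y => y / μ + 1)
        (Eventually.of_forall fun x => ?_) ?_ ((hFi.div_const _).add (integrable_const _)) ?_
      · exact ((continuous_stepDefect μ).comp
          (Continuous.prodMk_right x)).aestronglyMeasurable
      · filter_upwards [eventually_ge_atTop 0] with x hx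
        filter_upwards [hF0] with y hy
        exact abs_stepDefect_le hμ hx hy
      · exact Eventually.of_forall fun y => tendsto_stepDefect μ y
    rw [integral_zero] at h
    refine h.congr' ?_
    filter_upwards [eventually_ge_atTop 0] with x hx
    exact (hn.centredPrimitive_sub_conv hF hFi hμ hx).symm
  -- By the Lipschitz property `W x * μ` differs from the window average at `x` by at most `K ∫ y²
  -- dF`, and those averages are already bounded.
  have hbound : ∀ x, |W x| ≤ ((∫ y, (y ^ 2 / (2 * μ) + y + 1) ∂F) + K * ∫ y, y ^ 2 ∂F) / μ := by
    have hM0 : 0 ≤ ∫ y, (y ^ 2 / (2 * μ) + y + 1) ∂F := integral_nonneg_of_ae <| by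
      filter_upwards [hF0] with y hy
      show 0 ≤ y ^ 2 / (2 * μ) + y + 1
      positivity
    have hS0 : 0 ≤ ∫ y, y ^ 2 ∂F := integral_nonneg fun y => sq_nonneg y
    intro x
    rcases lt_or_ge x 0 with hx | hx
    · rw [hWc.zero_of_neg x hx, abs_zero]; positivity
    have h1 : |∫ y, (∫ s in (0 : ℝ)..y, W (x - s)) ∂F|
        ≤ ∫ y, (y ^ 2 / (2 * μ) + y + 1) ∂F := by
      rw [hdefect x hx, ← Real.norm_eq_abs]
      refine norm_integral_le_of_norm_le hdom ?_
      filter_upwards [hF0] with y hy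
      exact abs_integral_stepDefect_le hμ hx hy
    have hcont : Continuous fun s => W (x - s) := hLip.continuous.comp (by fun_prop)
    have hpw : ∀ᵐ y ∂F, ‖W x * y - ∫ s in (0 : ℝ)..y, W (x - s)‖ ≤ K * y ^ 2 := by
      filter_upwards [hF0] with y hy
      have h2 : W x * y - ∫ s in (0 : ℝ)..y, W (x - s)
          = ∫ s in (0 : ℝ)..y, (W x - W (x - s)) := by
        rw [intervalIntegral.integral_sub intervalIntegrable_const
          (hcont.intervalIntegrable _ _), intervalIntegral.integral_const, smul_eq_mul, sub_zero,
          mul_comm]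
      rw [h2]
      have h3 := intervalIntegral.norm_integral_le_of_norm_le_const (a := 0) (b := y)
        (f := fun s => W x - W (x - s)) (C := K * y) fun s hs => by
          rw [Set.uIoc_of_le hy] at hs
          have h4 := hLip.dist_le_mul x (x - s)
          rw [Real.dist_eq, Real.dist_eq, sub_sub_cancel, abs_of_pos hs.1] at h4
          exact h4.trans (mul_le_mul_of_nonneg_left hs.2 K.2)
      rw [sub_zero, abs_of_nonneg hy] at h3
      exact h3.trans_eq (by ring)
    have hmeas : AEStronglyMeasurable (fun y => ∫ s in (0 : ℝ)..y, W (x - s)) F :=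
      (intervalIntegral.continuous_primitive
        (fun a b => hcont.intervalIntegrable a b) 0).aestronglyMeasurable
    have hi1 : Integrable (fun y => W x * y - ∫ s in (0 : ℝ)..y, W (x - s)) F :=
      Integrable.mono' (hF2.const_mul _) ((hFi.const_mul _).aestronglyMeasurable.sub hmeas) hpw
    have hi2 : Integrable (fun y => ∫ s in (0 : ℝ)..y, W (x - s)) F := by
      refine ((hFi.const_mul (W x)).sub hi1).congr (Eventually.of_forall fun y => ?_)
      simp
    have h5 : |W x * μ - ∫ y, (∫ s in (0 : ℝ)..y, W (x - s)) ∂F| ≤ K * ∫ y, y ^ 2 ∂F := by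
      have h6 := norm_integral_le_of_norm_le (hF2.const_mul _) hpw
      rwa [integral_sub (hFi.const_mul _) hi2, integral_const_mul, integral_const_mul] at h6
    rw [le_div_iff₀ hμ]
    calc |W x| * μ = |W x * μ| := by rw [abs_mul, abs_of_pos hμ]
      _ = |(W x * μ - ∫ y, (∫ s in (0 : ℝ)..y, W (x - s)) ∂F)
            + ∫ y, (∫ s in (0 : ℝ)..y, W (x - s)) ∂F| := by rw [sub_add_cancel]
      _ ≤ _ := by
          refine (abs_add_le _ _).trans ?_
          linarith
  exact tendsto_of_renewal hF0 hFi hμ hdense hLip hbound hw hJ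

end IsRenewalSeq

/-! ### From split vectors to the step law -/

theorem MeasureTheory.Measure.map_withDensity_comp {α β : Type*} [MeasurableSpace α]
    [MeasurableSpace β] (μ : Measure α) {f : α → β} (hf : Measurable f) {g : β → ENNReal}
    (hg : Measurable g) :
    (μ.withDensity fun a => g (f a)).map f = (μ.map f).withDensity g := by
  ext A hA
  rw [Measure.map_apply hf hA, withDensity_apply _ (hf hA), withDensity_apply _ hA,
    setLIntegral_map hA hg hf]

/-- The support of a measure that is not carried by a lattice generates a dense subgroup. -/
theorem dense_closure_support {F : Measure ℝ}
    (h : ¬ ∃ d : ℝ, 0 < d ∧ ∀ᵐ y ∂F, ∃ n : ℤ, y = n * d) :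
    Dense (AddSubgroup.closure F.support : Set ℝ) := by
  rcases (AddSubgroup.closure F.support).dense_or_cyclic with hd | ⟨a, ha⟩
  · exact hd
  refine absurd ?_ h
  have hsupp : ∀ᵐ y ∂F, ∃ n : ℤ, y = n * a := by
    filter_upwards [Measure.support_mem_ae (μ := F)] with y hy
    have hy' := AddSubgroup.subset_closure hy
    rw [SetLike.mem_coe, ha, ← AddSubgroup.zmultiples_eq_closure,
      AddSubgroup.mem_zmultiples_iff] at hy'
    obtain ⟨n, hn⟩ := hy'
    exact ⟨n, by rw [← hn, zsmul_eq_mul]⟩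
  -- The generator may be negative or zero, while a span must be positive; a measure carried by
  -- `{0}` is lattice with any span.
  rcases lt_trichotomy a 0 with h0 | h0 | h0
  · refine ⟨-a, neg_pos.2 h0, hsupp.mono fun y ⟨n, hn⟩ => ⟨-n, by rw [hn]; simp⟩⟩
  · exact ⟨1, one_pos, hsupp.mono fun y ⟨n, hn⟩ => ⟨0, by rw [hn, h0]; simp⟩⟩
  · exact ⟨a, h0, hsupp⟩

namespace SplitTree

section Split

variable {Ω : Type*} [MeasurableSpace Ω] {P : Measure Ω} {b : ℕ}
  {𝒱 : Ω → Fin b → ℝ} {V : Ω → ℝ}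

/-- The law of `-ln Δ`. -/
noncomputable def stepLaw (P : Measure Ω) (𝒱 : Ω → Fin b → ℝ) : Measure ℝ :=
  (sizeBiasedLaw P 𝒱).map fun x => -Real.log x

theorem measurable_neg_log : Measurable fun x : ℝ => -Real.log x := Real.measurable_log.neg

theorem mu_eq_integral_stepLaw : mu P 𝒱 = ∫ y, y ∂(stepLaw P 𝒱) := by
  rw [stepLaw, integral_map measurable_neg_log.aemeasurable (by fun_prop), mu]

theorem sizeBiasedLaw_eq (h𝒱 : IsSplitVector P 𝒱)
    (hV : ∀ i, IdentDistrib (fun ω => 𝒱 ω i) V P P) :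
    sizeBiasedLaw P 𝒱 = (b : ENNReal) • (P.map V).withDensity ENNReal.ofReal := by
  have h : ∀ j, (P.withDensity fun ω => ENNReal.ofReal (𝒱 ω j)).map (fun ω => 𝒱 ω j)
      = (P.map V).withDensity ENNReal.ofReal := fun j => by
    have hj : Measurable fun ω => 𝒱 ω j := (measurable_pi_apply j).comp h𝒱.measurable
    rw [Measure.map_withDensity_comp P hj ENNReal.measurable_ofReal, (hV j).map_eq]
  simp [sizeBiasedLaw, h, Nat.cast_smul_eq_nsmul]

variable [IsProbabilityMeasure P]

theorem IsSplitVector.pos (h𝒱 : IsSplitVector P 𝒱) : 0 < b := by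
  rcases Nat.eq_zero_or_pos b with rfl | hb
  · obtain ⟨ω, hω⟩ := h𝒱.sum_eq_one.exists
    simp at hω
  · exact hb

theorem IsSplitVector.ae_mem_Ioo (h𝒱 : IsSplitVector P 𝒱)
    (hV : ∀ i, IdentDistrib (fun ω => 𝒱 ω i) V P P)
    (hV_one : P {ω | V ω = 1} = 0) (hV_zero : P {ω | V ω = 0} = 0) :
    ∀ᵐ ω ∂P, V ω ∈ Set.Ioo 0 1 := by
  have hmem : ∀ᵐ ω ∂P, 𝒱 ω ⟨0, h𝒱.pos⟩ ∈ Set.Icc 0 1 := by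
    filter_upwards [h𝒱.nonneg, h𝒱.sum_eq_one] with ω h0 h1
    exact ⟨h0 _, h1 ▸ Finset.single_le_sum (fun i _ => h0 i) (Finset.mem_univ _)⟩
  have h1 : ∀ᵐ ω ∂P, V ω ≠ 1 := by rw [ae_iff]; simpa using hV_one
  have h0 : ∀ᵐ ω ∂P, V ω ≠ 0 := by rw [ae_iff]; simpa using hV_zero
  filter_upwards [(hV ⟨0, h𝒱.pos⟩).ae_snd (p := fun x => x ∈ Set.Icc 0 1) measurableSet_Icc hmem,
    h0, h1] with ω hω h0 h1
  exact ⟨lt_of_le_of_ne hω.1 h0.symm, lt_of_le_of_ne hω.2 h1⟩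

theorem isProbabilityMeasure_sizeBiasedLaw (h𝒱 : IsSplitVector P 𝒱) :
    IsProbabilityMeasure (sizeBiasedLaw P 𝒱) := by
  refine ⟨?_⟩
  rw [sizeBiasedLaw_apply P 𝒱 h𝒱.measurable MeasurableSet.univ]
  simp only [Set.mem_univ, Set.ofPred_true, Measure.restrict_univ]
  have hj : ∀ j, Measurable fun ω => ENNReal.ofReal (𝒱 ω j) := fun j =>
    ENNReal.measurable_ofReal.comp ((measurable_pi_apply j).comp h𝒱.measurable)
  rw [← lintegral_finsetSum _ fun j _ => hj j]
  have h : ∀ᵐ ω ∂P, ∑ j, ENNReal.ofReal (𝒱 ω j) = 1 := by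
    filter_upwards [h𝒱.nonneg, h𝒱.sum_eq_one] with ω h0 h1
    rw [← ENNReal.ofReal_sum_of_nonneg fun j _ => h0 j, h1, ENNReal.ofReal_one]
  rw [lintegral_congr_ae h]
  simp

theorem isProbabilityMeasure_stepLaw (h𝒱 : IsSplitVector P 𝒱) :
    IsProbabilityMeasure (stepLaw P 𝒱) :=
  have := isProbabilityMeasure_sizeBiasedLaw h𝒱
  Measure.isProbabilityMeasure_map measurable_neg_log.aemeasurable

/-- The size-biasing factor `V` is `e^{-y}` at `y = -ln V`, which uses `V > 0` almost surely. -/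
theorem stepLaw_eq (h𝒱 : IsSplitVector P 𝒱) (hV : ∀ i, IdentDistrib (fun ω => 𝒱 ω i) V P P)
    (hV01 : ∀ᵐ ω ∂P, V ω ∈ Set.Ioo 0 1) :
    stepLaw P 𝒱 = (P.map fun ω => -Real.log (V ω)).withDensity
      fun y => ENNReal.ofReal (b * Real.exp (-y)) := by
  have hVm : AEMeasurable V P := (hV ⟨0, h𝒱.pos⟩).aemeasurable_snd
  have hmap : (P.map fun ω => -Real.log (V ω)) = (P.map V).map fun x => -Real.log x :=
    (AEMeasurable.map_map_of_aemeasurable measurable_neg_log.aemeasurable hVm).symm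
  have hpos : ∀ᵐ x ∂(P.map V), 0 < x :=
    (ae_map_iff hVm measurableSet_Ioi).2 (hV01.mono fun ω hω => hω.1)
  have hdens : Measurable fun y : ℝ => ENNReal.ofReal (b * Real.exp (-y)) := by fun_prop
  rw [stepLaw, sizeBiasedLaw_eq h𝒱 hV, hmap, ← Measure.map_withDensity_comp _
    measurable_neg_log hdens, ← withDensity_smul _ ENNReal.measurable_ofReal]
  congr 1
  refine withDensity_congr_ae ?_
  filter_upwards [hpos] with x hx
  rw [neg_neg, Real.exp_log hx, ENNReal.ofReal_mul (Nat.cast_nonneg b), ENNReal.ofReal_natCast]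
  rfl

theorem integral_stepLaw (h𝒱 : IsSplitVector P 𝒱)
    (hV : ∀ i, IdentDistrib (fun ω => 𝒱 ω i) V P P) (hV01 : ∀ᵐ ω ∂P, V ω ∈ Set.Ioo 0 1)
    (g : ℝ → ℝ) :
    ∫ y, g y ∂(stepLaw P 𝒱)
      = ∫ y, b * Real.exp (-y) * g y ∂(P.map fun ω => -Real.log (V ω)) := by
  rw [stepLaw_eq h𝒱 hV hV01, integral_withDensity_eq_integral_toReal_smul (by fun_prop)
    (Eventually.of_forall fun _ => ENNReal.ofReal_lt_top)]
  refine integral_congr_ae (Eventually.of_forall fun y => ?_)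
  simp only [smul_eq_mul]
  rw [ENNReal.toReal_ofReal (by positivity)]

theorem ae_stepLaw_pos (h𝒱 : IsSplitVector P 𝒱)
    (hV : ∀ i, IdentDistrib (fun ω => 𝒱 ω i) V P P) (hV01 : ∀ᵐ ω ∂P, V ω ∈ Set.Ioo 0 1) :
    ∀ᵐ y ∂(stepLaw P 𝒱), 0 < y := by
  have hVm : AEMeasurable V P := (hV ⟨0, h𝒱.pos⟩).aemeasurable_snd
  have h : ∀ᵐ y ∂(P.map fun ω => -Real.log (V ω)), 0 < y := by
    refine (ae_map_iff (measurable_neg_log.comp_aemeasurable hVm) measurableSet_Ioi).2 ?_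
    filter_upwards [hV01] with ω hω
    exact neg_pos.2 (Real.log_neg hω.1 hω.2)
  rw [stepLaw_eq h𝒱 hV hV01]
  exact withDensity_absolutelyContinuous _ _ h

/-- The tilting density is strictly positive, so a lattice carrying the step law would also carry
the law of `-ln V`. -/
theorem dense_closure_support_stepLaw (h𝒱 : IsSplitVector P 𝒱)
    (hV : ∀ i, IdentDistrib (fun ω => 𝒱 ω i) V P P) (hV01 : ∀ᵐ ω ∂P, V ω ∈ Set.Ioo 0 1)
    (hV_nonlattice : NonLattice P fun ω => -Real.log (V ω)) :
    Dense (AddSubgroup.closure (stepLaw P 𝒱).support : Set ℝ) := by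
  have hVm : AEMeasurable V P := (hV ⟨0, h𝒱.pos⟩).aemeasurable_snd
  have hb : (0 : ℝ) < b := Nat.cast_pos.2 h𝒱.pos
  refine dense_closure_support fun ⟨d, hd, h⟩ => hV_nonlattice ⟨d, hd, ?_⟩
  have hac : (P.map fun ω => -Real.log (V ω)) ≪ stepLaw P 𝒱 := by
    rw [stepLaw_eq h𝒱 hV hV01]
    refine withDensity_absolutelyContinuous' (by fun_prop) (Eventually.of_forall fun y => ?_)
    exact (ENNReal.ofReal_pos.2 (by positivity)).ne'
  exact ae_of_ae_map (measurable_neg_log.comp_aemeasurable hVm) (hac h)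

/-- No moment of `ln V` is needed: the tilt bounds the integrand, since `y² e^{-y} ≤ 2` for `y ≥ 0`.
-/
theorem integrable_sq_stepLaw (h𝒱 : IsSplitVector P 𝒱)
    (hV : ∀ i, IdentDistrib (fun ω => 𝒱 ω i) V P P) (hV01 : ∀ᵐ ω ∂P, V ω ∈ Set.Ioo 0 1) :
    Integrable (fun y => y ^ 2) (stepLaw P 𝒱) := by
  have hVm : AEMeasurable V P := (hV ⟨0, h𝒱.pos⟩).aemeasurable_snd
  have hXm := measurable_neg_log.comp_aemeasurable hVm
  have hpos : ∀ᵐ y ∂(P.map fun ω => -Real.log (V ω)), 0 < y := by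
    refine (ae_map_iff hXm measurableSet_Ioi).2 ?_
    filter_upwards [hV01] with ω hω
    exact neg_pos.2 (Real.log_neg hω.1 hω.2)
  rw [stepLaw_eq h𝒱 hV hV01, integrable_withDensity_iff_integrable_smul' (by fun_prop)
    (Eventually.of_forall fun _ => ENNReal.ofReal_lt_top)]
  have : IsProbabilityMeasure (P.map fun ω => -Real.log (V ω)) :=
    Measure.isProbabilityMeasure_map hXm
  refine Integrable.of_bound (by fun_prop) (2 * b) ?_
  filter_upwards [hpos] with y hy
  rw [ENNReal.toReal_ofReal (by positivity), Real.norm_eq_abs, smul_eq_mul,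
    abs_of_nonneg (by positivity)]
  have h1 : y ^ 2 ≤ 2 * Real.exp y := by linarith [Real.quadratic_le_exp_of_nonneg hy.le]
  calc b * Real.exp (-y) * y ^ 2 ≤ b * Real.exp (-y) * (2 * Real.exp y) := by gcongr
    _ = 2 * b := by rw [Real.exp_neg]; field_simp

theorem memLp_log_sizeBiasedLaw (h𝒱 : IsSplitVector P 𝒱)
    (hV : ∀ i, IdentDistrib (fun ω => 𝒱 ω i) V P P) (hV01 : ∀ᵐ ω ∂P, V ω ∈ Set.Ioo 0 1) :
    MemLp Real.log 2 (sizeBiasedLaw P 𝒱) := by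
  rw [memLp_two_iff_integrable_sq Real.measurable_log.aestronglyMeasurable]
  have h := (integrable_map_measure (by fun_prop) measurable_neg_log.aemeasurable).1
    (integrable_sq_stepLaw h𝒱 hV hV01)
  simpa [Function.comp_def] using h

theorem sigmaSq_eq_integral_stepLaw (h𝒱 : IsSplitVector P 𝒱)
    (h : MemLp Real.log 2 (sizeBiasedLaw P 𝒱)) :
    sigmaSq P 𝒱 = (∫ y, y ^ 2 ∂(stepLaw P 𝒱)) - mu P 𝒱 ^ 2 := by
  have := isProbabilityMeasure_sizeBiasedLaw h𝒱
  rw [sigmaSq, variance_eq_sub h, stepLaw,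
    integral_map measurable_neg_log.aemeasurable (by fun_prop), mu, integral_neg]
  simp

end Split

/-! ### The renewal recursion for `ν_k` -/

section Renewal

variable {Ω' : Type*} [MeasurableSpace Ω'] {Q : Measure Ω'} [IsProbabilityMeasure Q]
  {W : ℕ → Ω' → ℝ}

theorem monotone_nu (b k : ℕ) : Monotone (nu Q b W k) := fun s t hst =>
  mul_le_mul_of_nonneg_left (measureReal_mono fun _ hω => le_trans hω hst) (by positivity)

theorem nu_zero (b : ℕ) (t : ℝ) : nu Q b W 0 t = if 0 ≤ t then 1 else 0 := by
  by_cases h : 0 ≤ t <;> simp [nu, Y, h]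

/-- The recursion for `ν_k` obtained by conditioning on the last factor. -/
theorem nu_succ (hW_indep : iIndepFun W Q) (hWm : ∀ j, AEMeasurable (W j) Q) (b k : ℕ) (t : ℝ) :
    nu Q b W (k + 1) t = ∫ y, b * nu Q b W k (t - y) ∂(Q.map fun ω => -Real.log (W k ω)) := by
  have hXm : ∀ j, AEMeasurable (fun ω => -Real.log (W j ω)) Q := fun j =>
    measurable_neg_log.comp_aemeasurable (hWm j)
  have hsum : (∑ j ∈ Finset.range k, fun ω => -Real.log (W j ω)) = Y W k := by
    ext ω; simp [Y]
  have hYm : AEMeasurable (Y W k) Q := by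
    rw [← hsum]; exact Finset.aemeasurable_sum _ fun j _ => hXm j
  have hind : IndepFun (Y W k) (fun ω => -Real.log (W k ω)) Q := by
    rw [← hsum]
    exact (hW_indep.comp (fun _ x => -Real.log x) fun _ =>
      measurable_neg_log).indepFun_sum_range_succ₀ hXm k
  have hmeas : MeasurableSet {p : ℝ × ℝ | p.1 + p.2 ≤ t} :=
    measurableSet_le (by fun_prop) (by fun_prop)
  have hprob : IsProbabilityMeasure (Q.map (Y W k)) := Measure.isProbabilityMeasure_map hYm
  have hprob' := Measure.isProbabilityMeasure_map (hXm k)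
  have h1 : Q {ω | Y W (k + 1) ω ≤ t}
      = ∫⁻ y, Q {ω | Y W k ω ≤ t - y} ∂(Q.map fun ω => -Real.log (W k ω)) := by
    have h2 : {ω | Y W (k + 1) ω ≤ t}
        = (fun ω => (Y W k ω, -Real.log (W k ω))) ⁻¹' {p : ℝ × ℝ | p.1 + p.2 ≤ t} := by
      ext ω
      simp only [Y, Finset.sum_range_succ, neg_add, Set.mem_ofPred_eq, Set.mem_preimage]
    rw [h2, ← Measure.map_apply_of_aemeasurable (hYm.prodMk (hXm k)) hmeas,
      (indepFun_iff_map_prod_eq_prod_map_map hYm (hXm k)).1 hind, Measure.prod_apply_symm hmeas]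
    refine lintegral_congr fun y => ?_
    rw [Measure.map_apply_of_aemeasurable hYm (measurable_prodMk_right hmeas)]
    congr 1
    ext ω
    simp [le_sub_iff_add_le]
  have hmono : Monotone fun s => Q {ω | Y W k ω ≤ s} := fun s s' hs =>
    measure_mono fun ω hω => le_trans hω hs
  have hmeas' : Measurable fun y => Q {ω | Y W k ω ≤ t - y} :=
    hmono.measurable.comp (measurable_const.sub measurable_id)
  simp only [nu, measureReal_def]
  rw [h1, integral_const_mul, integral_const_mul, integral_toReal hmeas'.aemeasurable
    (Eventually.of_forall fun y => measure_lt_top _ _), pow_succ]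
  ring

/-- Splitting `e^{-t} = e^{-y} e^{-(t-y)}` puts `b e^{-y}` on the law of `-ln V`, which becomes the
step law. As `Y_0 = 0`, the index 0 term is the exponential density. -/
theorem isRenewalSeq_nu {Ω : Type*} [MeasurableSpace Ω] {P : Measure Ω} [IsProbabilityMeasure P]
    {b : ℕ} {𝒱 : Ω → Fin b → ℝ} {V : Ω → ℝ} (h𝒱 : IsSplitVector P 𝒱)
    (hV : ∀ i, IdentDistrib (fun ω => 𝒱 ω i) V P P) (hV01 : ∀ᵐ ω ∂P, V ω ∈ Set.Ioo 0 1)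
    (hW_indep : iIndepFun W Q) (hW_law : ∀ j, IdentDistrib (W j) V Q P) :
    IsRenewalSeq (stepLaw P 𝒱) fun k t => Real.exp (-t) * nu Q b W k t where
  zero t := by
    rw [nu_zero, expDensity]; split_ifs <;> simp
  succ k t := by
    have hlaw : (Q.map fun ω => -Real.log (W k ω)) = P.map fun ω => -Real.log (V ω) :=
      ((hW_law k).comp measurable_neg_log).map_eq
    rw [nu_succ hW_indep (fun j => (hW_law j).aemeasurable_fst), hlaw,
      integral_stepLaw h𝒱 hV hV01, ← integral_const_mul]
    refine integral_congr_ae (Eventually.of_forall fun y => ?_)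
    have h : Real.exp (-t) = Real.exp (-y) * Real.exp (-(t - y)) := by
      rw [← Real.exp_add]; congr 1; ring
    simp only [h]
    ring
  mono k := by
    have h : (fun t => Real.exp t * (Real.exp (-t) * nu Q b W k t)) = nu Q b W k := by
      ext t; rw [← mul_assoc, ← Real.exp_add]; simp
    rw [h]
    exact monotone_nu b k

end Renewal

end SplitTree

theorem mainTheorem8
    {Ω : Type*} [MeasurableSpace Ω] (P : Measure Ω) [IsProbabilityMeasure P]
    {Ω' : Type*} [MeasurableSpace Ω'] (Q : Measure Ω') [IsProbabilityMeasure Q]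
    (b : ℕ)
    -- the split vector, and a variable `V` with the common law of its components
    (𝒱 : Ω → Fin b → ℝ) (h𝒱 : SplitTree.IsSplitVector P 𝒱)
    (V : Ω → ℝ) (hV : ∀ i, IdentDistrib (fun ω => 𝒱 ω i) V P P)
    (hV_one : P {ω | V ω = 1} = 0) (hV_zero : P {ω | V ω = 0} = 0)
    (hV_nonlattice : SplitTree.NonLattice P fun ω => -Real.log (V ω))
    -- independent copies of `V`
    (W : ℕ → Ω' → ℝ) (hW_indep : iIndepFun W Q) (hW_law : ∀ j, IdentDistrib (W j) V Q P) :
    -- `ln Δ` has a finite second moment and `μ > 0`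
    MemLp Real.log 2 (SplitTree.sizeBiasedLaw P 𝒱) ∧
    0 < SplitTree.mu P 𝒱 ∧
    -- the series that defines `U(t)` converges
    (∀ t : ℝ, Summable fun k : ℕ => SplitTree.nu Q b W (k + 1) t) ∧
    -- the integral that defines the function `W(x)` exists
    (∀ x : ℝ, 0 ≤ x → IntervalIntegrable
      (fun t => Real.exp (-t) * (SplitTree.U Q b W t - (SplitTree.mu P 𝒱)⁻¹ * Real.exp t))
      volume 0 x) ∧
    Tendsto
      (fun x : ℝ => ∫ t in (0 : ℝ)..x,
        Real.exp (-t) * (SplitTree.U Q b W t - (SplitTree.mu P 𝒱)⁻¹ * Real.exp t))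
      atTop
      (𝓝 ((SplitTree.sigmaSq P 𝒱 - SplitTree.mu P 𝒱 ^ 2) / (2 * SplitTree.mu P 𝒱 ^ 2)
        - (SplitTree.mu P 𝒱)⁻¹)) := by
  have hV01 := h𝒱.ae_mem_Ioo hV hV_one hV_zero
  have hprob := SplitTree.isProbabilityMeasure_stepLaw h𝒱
  have hF := SplitTree.ae_stepLaw_pos h𝒱 hV hV01
  have hF2 := SplitTree.integrable_sq_stepLaw h𝒱 hV hV01
  have hFi : Integrable (fun y => y) (SplitTree.stepLaw P 𝒱) :=
    ((memLp_two_iff_integrable_sq (by fun_prop)).2 hF2).integrable one_le_two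
  have hlog := SplitTree.memLp_log_sizeBiasedLaw h𝒱 hV hV01
  have hμ : 0 < SplitTree.mu P 𝒱 := by
    rw [SplitTree.mu_eq_integral_stepLaw]
    exact integral_pos_of_ae_pos hFi hF
  have hn := SplitTree.isRenewalSeq_nu h𝒱 hV hV01 hW_indep hW_law
  have hrw : (fun t => Real.exp (-t) *
      (SplitTree.U Q b W t - (SplitTree.mu P 𝒱)⁻¹ * Real.exp t))
      = fun t => (∑' k, Real.exp (-t) * SplitTree.nu Q b W (k + 1) t)
        - (SplitTree.mu P 𝒱)⁻¹ := by
    ext t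
    rw [tsum_mul_left, SplitTree.U, mul_sub, mul_left_comm _ (SplitTree.mu P 𝒱)⁻¹,
      ← Real.exp_add, neg_add_cancel, Real.exp_zero, mul_one]
  have hint := (hn.isCausal_tsum hF).intervalIntegrable
  refine ⟨hlog, hμ, fun t => ?_, fun x _ => ?_, ?_⟩
  · exact (summable_mul_left_iff (Real.exp_ne_zero (-t))).1 (hn.summable hF t)
  · rw [hrw]
    exact (hint 0 x).sub intervalIntegrable_const
  · rw [hrw, SplitTree.sigmaSq_eq_integral_stepLaw h𝒱 hlog]
    have hlim := hn.tendsto_centredPrimitive hF hFi hF2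
      (SplitTree.mu_eq_integral_stepLaw (P := P) (𝒱 := 𝒱) ▸ hμ)
      (SplitTree.dense_closure_support_stepLaw h𝒱 hV hV01 hV_nonlattice)
    rw [← SplitTree.mu_eq_integral_stepLaw] at hlim
    -- With `σ² = ∫ y² dF - μ²`, this matches the stated constant with the limit `c / μ`.
    have hval : ((∫ y, y ^ 2 ∂(SplitTree.stepLaw P 𝒱)) - SplitTree.mu P 𝒱 ^ 2
        - SplitTree.mu P 𝒱 ^ 2) / (2 * SplitTree.mu P 𝒱 ^ 2) - (SplitTree.mu P 𝒱)⁻¹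
        = ((∫ y, y ^ 2 ∂(SplitTree.stepLaw P 𝒱)) / (2 * SplitTree.mu P 𝒱)
          - (1 + SplitTree.mu P 𝒱)) / SplitTree.mu P 𝒱 := by
      field_simp
      ring
    rw [hval]
    refine hlim.congr' ?_
    filter_upwards [eventually_ge_atTop 0] with x hx
    rw [centredPrimitive, intervalIntegral.integral_sub (hint 0 x) intervalIntegrable_const,
      intervalIntegral.integral_const, max_eq_left hx, sub_zero, smul_eq_mul, div_eq_mul_inv]
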